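/- Let $n\ge 0$, let $H_n=\mathbb{F}_2^n$ with Hamming distance $d(\cdot,\cdot)$, and let $C\subset H_n$. For $x_1,x_2,x_3\in H_n$ let $d(x_1,x_2,x_3)$ be the number of coordinates where $x_1,x_2,x_3$ are not all equal, $r(x_1,x_2,x_3)=\min_{y\in H_n}\max_i d(y,x_i)$ and $\overline r(x_1,x_2,x_3)=\min_{y\in H_n}\frac13\sum_i d(y,x_i)$. For $f=d,r,\overline r$ let $f_2(C)=\min f(x_1,x_2,x_3)$ over all triples of pairwise distinct elements of $C$ (with $f_2(C)=+\infty$ if there is no such triple). Let $\Omega$ be the set of $(a,b,c)\in\{0,\dots,n\}^3$ with $a+b+c$ even, $a+b+c\le 2n$, $c\le a+b$, $b\le a+c$, $a\le b+c$. For $(a,b,c)\in\Omega$ let $t(a,b,c)=\binom{c}{i}\binom{n-c}{a-i}$, where $2i=a-b+c$. For $0\le s\le t\le n$ and $0\le k\le\min(s,n-t)$ let $Q_k(n,s,t;\cdot)$ be the Hahn polynomial: the unique real polynomial of degree $k$ with value $1$ at $0$ that is orthogonal to all polynomials of degree $<k$ for the weights $w(n,s,t;i)=\binom{s}{i}\binom{n-s}{t-s+i}$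 on the points $i=0,\dots,s$. For $0\le k\le\lfloor n/2\rfloor$ and $(a,b,c)\in\Omega$ let $T_k(a,b,c)$ be the real matrix with rows and columns indexed by $\{k,\dots,n-k\}$ all of whose entries are $0$ except, when $k\le a,b\le n-k$, the entry in row $b$ and column $a$, which is $$2^n\,\frac{\binom{v-k}{u-k}\binom{n-2k}{v-k}}{\binom nv\binom vu}\;Q_k\!\left(n,u,v;\;u-\tfrac{a+b-c}{2}\right),\qquad u=\min(a,b),\quad v=\max(a,b).$$ Consider the semidefinite program in real variables $x_{a,b,c}$, $(a,b,c)\in\Omega$: maximize $\sum_{c=0}^n x_{0,c,c}$ subject to (i) $x_{0,0,0}=1$; (ii) $x_{a,b,c}\ge 0$; (iii) $x_{a,b,c}$ is invariant under all permutations of $(a,b,c)$; (iv) $x_{a,b,c}\le t(a,b,c)\,x_{0,c,c}$; (v) $x_{a,b,c}\le t(b,c,a)\,x_{0,a,a}$; (vi) $x_{a,b,c}\le t(c,a,b)\,x_{0,b,b}$; (vii) $\sum_{(a,b,c)\in\Omega}x_{a,b,c}\,T_k(a,b,c)\succeq 0$ for all $0\le k\le\lfloor n/2\rfloor$; (viii)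 $\sum_{(a,b,c)\in\Omega}\bigl(t(a,b,c)\,x_{0,c,c}-x_{a,b,c}\bigr)T_k(a,b,c)\succeq 0$ for all $0\le k\le\lfloor n/2\rfloor$; and one of the following conditions, where $d,r\ge 0$ are integers and $\overline r$ is a real number: (ix)$^d$ $x_{a,b,c}=0$ if $abc\ne 0$ and $a+b+c\le 2(d-1)$; (ix)$^r$ $x_{a,b,c}=0$ if $abc\ne 0$ and $\max(\lceil a/2\rceil,\lceil b/2\rceil,\lceil c/2\rceil)\le r-1$; (ix)$^{\overline r}$ $x_{a,b,c}=0$ if $abc\ne 0$ and $a+b+c<6\overline r$. Suppose that $d_2(C)\ge d$ (respectively $r_2(C)\ge r$, respectively $\overline r_2(C)\ge\overline r$). Then the program with (i)-(viii) and (ix)$^d$ (respectively (ix)$^r$, (ix)$^{\overline r}$) attains a finite maximum, and $|C|$ is at most this maximum. Moreover, if $C\neq\emptyset$, the numbers $$x_{a,b,c}=\frac1{|C|}\operatorname{card}\{(x,y,z)\in C^3: d(y,z)=a,\ d(x,z)=b,\ d(x,y)=c\}$$ form a feasible point of this program with $\sum_c x_{0,c,c}=|C|$. -/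

import Mathlib

noncomputable section

open Polynomial

/-! ### Binary Hamming space, pseudo-distances and code invariants -/

/-- The binary Hamming space `𝔽₂ⁿ`; its metric is `hammingDist`. -/
abbrev BinHamming (n : ℕ) : Type := Fin n → ZMod 2

/-- Generalized Hamming distance: the number of coordinates where the points are not all equal. -/
def genDist {n k : ℕ} (x : Fin k → BinHamming n) : ℕ :=
  (Finset.univ.filter fun j : Fin n => ∃ i i' : Fin k, x i j ≠ x i' j).card

/-- Radius: the smallest radius of a Hamming ball that contains all the points. -/
def radius {n k : ℕ} (x : Fin k → BinHamming n) : ℕ :=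
  sInf {r : ℕ | ∃ y : BinHamming n, ∀ i, hammingDist y (x i) ≤ r}

/-- Average radius: the minimum over all centers of the mean distance to the points
(the infimum is over a finite nonempty type). -/
def avgRadius {n k : ℕ} (x : Fin k → BinHamming n) : ℝ :=
  ⨅ y : BinHamming n, (1 / (k : ℝ)) * ∑ i, (hammingDist y (x i) : ℝ)

/-- Minimum of `f` over the `k`-tuples of pairwise distinct elements of `C`; it is `⊤` if there
are none, so that small codes satisfy every lower bound. -/
def codeMin {n k : ℕ} (f : (Fin k → BinHamming n) → ℝ) (C : Finset (BinHamming n)) : EReal :=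
  ⨅ x : {x : Fin k → BinHamming n // Function.Injective x ∧ ∀ i, x i ∈ C}, ((f x.1 : ℝ) : EReal)

/-- The invariant `d₂(C)`. -/
def d₂ {n : ℕ} (C : Finset (BinHamming n)) : EReal :=
  codeMin (fun x : Fin 3 → BinHamming n => (genDist x : ℝ)) C

/-- The invariant `r₂(C)`. -/
def r₂ {n : ℕ} (C : Finset (BinHamming n)) : EReal :=
  codeMin (fun x : Fin 3 → BinHamming n => (radius x : ℝ)) C

/-- The invariant `r̄₂(C)`. -/
def rbar₂ {n : ℕ} (C : Finset (BinHamming n)) : EReal :=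
  codeMin (fun x : Fin 3 → BinHamming n => avgRadius x) C

/-! ### Hahn polynomials -/

/-- The weights `w(n,s,t;i) = C(s,i) C(n-s,t-s+i)`. -/
def hahnWeight (n s t i : ℕ) : ℕ := s.choose i * (n - s).choose (t - s + i)

/-- The bilinear form given by the weights. -/
def hahnForm (n s t : ℕ) (P Q : ℝ[X]) : ℝ :=
  ∑ i ∈ Finset.range (s + 1), (hahnWeight n s t i : ℝ) * (P.eval (i : ℝ) * Q.eval (i : ℝ))

/-- `Q` is the Hahn polynomial of degree `k` for the parameters `n, s, t`. -/
structure IsHahn (n s t k : ℕ) (Q : ℝ[X]) : Prop where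
  natDegree_eq : Q.natDegree = k
  orthogonal : ∀ P : ℝ[X], P.degree < (k : WithBot ℕ) → hahnForm n s t Q P = 0
  eval_zero : Q.eval 0 = 1

theorem hahnWeight_pos {n s t k : ℕ} (hks : k ≤ s) (hst : s ≤ t) (htk : t + k ≤ n) :
    0 < hahnWeight n s t k := by
  unfold hahnWeight
  exact Nat.mul_pos (Nat.choose_pos hks) (Nat.choose_pos (by omega))

theorem hahnForm_self {n s t k : ℕ} (hks : k ≤ s) (hst : s ≤ t) (htk : t + k ≤ n) {P : ℝ[X]}
    (hdeg : P.degree < ((k + 1 : ℕ) : WithBot ℕ)) (h : hahnForm n s t P P = 0) : P = 0 := by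
  unfold hahnForm at h
  rw [Finset.sum_eq_zero_iff_of_nonneg
    (fun i _ => mul_nonneg (Nat.cast_nonneg _) (mul_self_nonneg _))] at h
  have hz : ∀ i ∈ Finset.range (k + 1), P.eval ((i : ℕ) : ℝ) = 0 := by
    intro i hi
    have hi' : i ≤ k := by simpa [Nat.lt_succ_iff] using hi
    have h1 := h i (by simp; omega)
    have h2 : (hahnWeight n s t i : ℝ) ≠ 0 := by
      exact_mod_cast (hahnWeight_pos (hi'.trans hks) hst (by omega)).ne'
    simpa [h2] using h1
  refine Polynomial.eq_zero_of_degree_lt_of_eval_index_eq_zero (v := fun i : ℕ => (i : ℝ))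
    (s := Finset.range (k + 1)) (fun i _ j _ hij => by simpa using hij) (by simpa using hdeg) hz

theorem IsHahn.unique {n s t k : ℕ} (hks : k ≤ s) (hst : s ≤ t) (htk : t + k ≤ n) {P Q : ℝ[X]}
    (hP : IsHahn n s t k P) (hQ : IsHahn n s t k Q) : P = Q := by
  have hP0 : P ≠ 0 := by rintro rfl; simpa using hP.eval_zero
  have hQ0 : Q ≠ 0 := by rintro rfl; simpa using hQ.eval_zero
  have hp : P.leadingCoeff ≠ 0 := leadingCoeff_ne_zero.mpr hP0
  have hq : Q.leadingCoeff ≠ 0 := leadingCoeff_ne_zero.mpr hQ0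
  set D := C Q.leadingCoeff * P - C P.leadingCoeff * Q with hD
  have hdP : (C Q.leadingCoeff * P).degree = k := by
    rw [degree_C_mul hq, degree_eq_natDegree hP0, hP.natDegree_eq]
  have hdQ : (C P.leadingCoeff * Q).degree = k := by
    rw [degree_C_mul hp, degree_eq_natDegree hQ0, hQ.natDegree_eq]
  have hdeg : D.degree < (k : WithBot ℕ) := by
    rw [← hdP]
    refine degree_sub_lt_left (hdP.trans hdQ.symm) (mul_ne_zero (by simpa using hq) hP0) ?_
    simp [mul_comm]
  have hform : hahnForm n s t D D = 0 := by
    have h1 := hP.orthogonal D hdeg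
    have h2 := hQ.orthogonal D hdeg
    have : hahnForm n s t D D
        = Q.leadingCoeff * hahnForm n s t P D - P.leadingCoeff * hahnForm n s t Q D := by
      simp only [hahnForm, Finset.mul_sum, ← Finset.sum_sub_distrib]
      refine Finset.sum_congr rfl fun i _ => ?_
      have : D.eval (i : ℝ) = Q.leadingCoeff * P.eval (i : ℝ) - P.leadingCoeff * Q.eval (i : ℝ) := by
        simp [hD]
      nth_rewrite 1 [this]
      ring
    rw [this, h1, h2]; ring
  have hD0 : D = 0 := hahnForm_self hks hst htk
    (hdeg.trans (by exact_mod_cast Nat.lt_succ_self k)) hform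
  have hc : Q.leadingCoeff = P.leadingCoeff := by
    have := congrArg (eval 0) hD0
    simp only [hD, eval_sub, eval_mul, eval_C, hP.eval_zero, hQ.eval_zero, Polynomial.eval_zero] at this
    linarith
  have h3 : C P.leadingCoeff * P = C P.leadingCoeff * Q := by
    rw [hD, hc] at hD0
    exact sub_eq_zero.mp hD0
  exact mul_left_cancel₀ (by simpa using hp) h3

theorem exists_isHahn {n s t k : ℕ} (hks : k ≤ s) (hst : s ≤ t) (htk : t + k ≤ n) :
    ∃ Q : ℝ[X], IsHahn n s t k Q := by
  let φ : degreeLT ℝ (k + 1) →ₗ[ℝ] (Fin k → ℝ) :=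
    { toFun := fun P j => hahnForm n s t P.1 (X ^ (j : ℕ))
      map_add' := fun P R => by
        ext j
        simp only [hahnForm, Submodule.coe_add, eval_add, Pi.add_apply, ← Finset.sum_add_distrib]
        exact Finset.sum_congr rfl fun i _ => by ring
      map_smul' := fun r P => by
        ext j
        simp only [hahnForm, Submodule.coe_smul, eval_smul, smul_eq_mul, Pi.smul_apply,
          RingHom.id_apply, Finset.mul_sum]
        exact Finset.sum_congr rfl fun i _ => by ring }
  have hker : LinearMap.ker φ ≠ ⊥ := by
    apply LinearMap.ker_ne_bot_of_finrank_lt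
    rw [(degreeLTEquiv ℝ (k + 1)).finrank_eq]
    simp
  obtain ⟨⟨P, hPmem⟩, hPker, hPne⟩ := Submodule.exists_mem_ne_zero_of_ne_bot hker
  have hP0 : P ≠ 0 := fun h => hPne (Subtype.ext h)
  have hPdeg : P.degree < ((k + 1 : ℕ) : WithBot ℕ) := mem_degreeLT.mp hPmem
  have hX : ∀ j < k, hahnForm n s t P (X ^ j) = 0 := fun j hj =>
    congrFun (LinearMap.mem_ker.mp hPker) ⟨j, hj⟩
  have horth : ∀ R : ℝ[X], R.degree < (k : WithBot ℕ) → hahnForm n s t P R = 0 := by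
    intro R hR
    have hR' : R.natDegree < k ∨ R = 0 := by
      by_cases h : R = 0
      · exact Or.inr h
      · exact Or.inl ((natDegree_lt_iff_degree_lt h).mpr hR)
    rcases hR' with h | rfl
    · have : hahnForm n s t P R
          = ∑ j ∈ Finset.range k, R.coeff j * hahnForm n s t P (X ^ j) := by
        simp only [hahnForm, Finset.mul_sum]
        rw [Finset.sum_comm]
        refine Finset.sum_congr rfl fun i _ => ?_
        rw [eval_eq_sum_range' h, Finset.mul_sum, Finset.mul_sum]
        exact Finset.sum_congr rfl fun j _ => by simp; ring
      rw [this]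
      exact Finset.sum_eq_zero fun j hj => by rw [hX j (Finset.mem_range.mp hj), mul_zero]
    · simp [hahnForm]
  have hdeg : P.natDegree = k := by
    have h1 : P.natDegree < k + 1 := (natDegree_lt_iff_degree_lt hP0).mpr hPdeg
    by_contra hne
    have h2 : P.degree < (k : WithBot ℕ) := (natDegree_lt_iff_degree_lt hP0).mp (by omega)
    exact hP0 (hahnForm_self hks hst htk hPdeg (horth P h2))
  have hev : P.eval 0 ≠ 0 := by
    intro h0
    obtain ⟨R, rfl⟩ := (X_dvd_iff (f := P)).mpr (by rwa [coeff_zero_eq_eval_zero])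
    have hR0 : R ≠ 0 := by rintro rfl; simp at hP0
    rw [natDegree_X_mul hR0] at hdeg
    have h1 : R.degree < (k : WithBot ℕ) := (natDegree_lt_iff_degree_lt hR0).mp (by omega)
    have h2 := horth R h1
    unfold hahnForm at h2
    have hnn : ∀ i ∈ Finset.range (s + 1),
        0 ≤ (hahnWeight n s t i : ℝ) * ((X * R).eval (i : ℝ) * R.eval (i : ℝ)) := by
      intro i _
      have : (X * R).eval (i : ℝ) * R.eval (i : ℝ)
          = (i : ℝ) * (R.eval (i : ℝ) * R.eval (i : ℝ)) := by simp; ring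
      rw [this]
      exact mul_nonneg (Nat.cast_nonneg _) (mul_nonneg (Nat.cast_nonneg _) (mul_self_nonneg _))
    rw [Finset.sum_eq_zero_iff_of_nonneg hnn] at h2
    apply hR0
    refine Polynomial.eq_zero_of_degree_lt_of_eval_index_eq_zero (v := fun i : ℕ => (i : ℝ))
      (s := Finset.Icc 1 k) (fun i _ j _ hij => by simpa using hij) (by simpa using h1) ?_
    intro i hi
    obtain ⟨hi1, hik⟩ := Finset.mem_Icc.mp hi
    have h3 := h2 i (by simp; omega)
    have h4 : (hahnWeight n s t i : ℝ) ≠ 0 := by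
      exact_mod_cast (hahnWeight_pos (hik.trans hks) hst (by omega)).ne'
    have h5 : (i : ℝ) ≠ 0 := by exact_mod_cast (by omega : i ≠ 0)
    simpa [h4, h5] using h3
  refine ⟨C (P.eval 0)⁻¹ * P, ?_, ?_, ?_⟩
  · rw [natDegree_C_mul (inv_ne_zero hev), hdeg]
  · intro R hR
    have : hahnForm n s t (C (P.eval 0)⁻¹ * P) R = (P.eval 0)⁻¹ * hahnForm n s t P R := by
      simp only [hahnForm, Finset.mul_sum, eval_mul, eval_C]
      exact Finset.sum_congr rfl fun i _ => by ring
    rw [this, horth R hR, mul_zero]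
  · rw [eval_mul, eval_C, inv_mul_cancel₀ hev]

open Classical in
/-- The Hahn polynomial `Q_k(n,s,t; ·)`, for `0 ≤ s ≤ t ≤ n` and `k ≤ min(s, n-t)`
(and `0` for the parameters where there is none). -/
def hahn (n s t k : ℕ) : ℝ[X] :=
  if h : ∃ Q : ℝ[X], IsHahn n s t k Q then h.choose else 0

theorem isHahn_hahn {n s t k : ℕ} (hks : k ≤ s) (hst : s ≤ t) (htk : t + k ≤ n) :
    IsHahn n s t k (hahn n s t k) := by
  have h := exists_isHahn hks hst htk
  rw [hahn, dif_pos h]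
  exact h.choose_spec

/-- Distinct Hahn polynomials are orthogonal. -/
theorem hahnForm_hahn {n s t k l : ℕ} (hks : k ≤ s) (hst : s ≤ t) (htk : t + k ≤ n) (hlk : l < k) :
    hahnForm n s t (hahn n s t k) (hahn n s t l) = 0 := by
  refine (isHahn_hahn hks hst htk).orthogonal _ (lt_of_le_of_lt degree_le_natDegree ?_)
  rw [(isHahn_hahn (hlk.le.trans hks) hst (by omega)).natDegree_eq]
  exact_mod_cast hlk

/-! ### The matrices `T_k(a,b,c)` -/

/-- For `k ≤ s ≤ t ≤ n-k`, the value of the zonal function `E_{k,s,t}(x,y)` for words `x, y` of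
weights `s, t` whose supports meet in `m` coordinates. -/
def zonal (n k s t : ℕ) (m : ℝ) : ℝ :=
  (2 : ℝ) ^ n * (((t - k).choose (s - k) : ℝ) * ((n - 2 * k).choose (t - k) : ℝ)
    / ((n.choose t : ℝ) * (t.choose s : ℝ))) * (hahn n s t k).eval ((s : ℝ) - m)

/-- `T_k(a,b,c) = E_k(x - z, y - z)` for `d(y,z) = a`, `d(x,z) = b`, `d(x,y) = c`: the words
`x - z` and `y - z` have weights `b` and `a`, and their supports meet in `(a+b-c)/2` coordinates.
For `s > t` one uses `E_{k,s,t}(x,y) = E_{k,t,s}(y,x)`. -/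
def schrijverT (n k a b c : ℕ) :
    Matrix (Finset.Icc k (n - k)) (Finset.Icc k (n - k)) ℝ :=
  Matrix.of fun s t =>
    if s.1 = b ∧ t.1 = a then
      if s.1 ≤ t.1 then zonal n k s.1 t.1 (((a : ℝ) + b - c) / 2)
      else zonal n k t.1 s.1 (((a : ℝ) + b - c) / 2)
    else 0

/-! ### The semidefinite program -/

/-- The index set `Ω` of the unknowns. -/
def Omega (n : ℕ) : Finset (ℕ × ℕ × ℕ) :=
  (Finset.range (n + 1) ×ˢ Finset.range (n + 1) ×ˢ Finset.range (n + 1)).filter fun p =>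
    (p.1 + p.2.1 + p.2.2) % 2 = 0 ∧ p.1 + p.2.1 + p.2.2 ≤ 2 * n ∧
      p.2.2 ≤ p.1 + p.2.1 ∧ p.2.1 ≤ p.1 + p.2.2 ∧ p.1 ≤ p.2.1 + p.2.2

/-- `t(a,b,c) = C(c,i) C(n-c,a-i)` with `2i = a-b+c`, for `(a,b,c) ∈ Ω`. -/
def tCount (n a b c : ℕ) : ℕ :=
  c.choose ((a + c - b) / 2) * (n - c).choose (a - (a + c - b) / 2)

/-- Feasibility of `x = (x_{a,b,c})_{(a,b,c) ∈ Ω}`, extended by `0` outside `Ω`, for the program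
in which the triples in `I` are forbidden. -/
structure SDPFeasible (n : ℕ) (I : Set (ℕ × ℕ × ℕ)) (x : ℕ → ℕ → ℕ → ℝ) : Prop where
  support : ∀ a b c, (a, b, c) ∉ Omega n → x a b c = 0
  normalized : x 0 0 0 = 1
  nonneg : ∀ a b c, (a, b, c) ∈ Omega n → 0 ≤ x a b c
  symm : ∀ (p : Fin 3 → ℕ) (τ : Equiv.Perm (Fin 3)), (p 0, p 1, p 2) ∈ Omega n →
    x (p 0) (p 1) (p 2) = x (p (τ 0)) (p (τ 1)) (p (τ 2))
  le_c : ∀ a b c, (a, b, c) ∈ Omega n → x a b c ≤ tCount n a b c * x 0 c c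
  le_a : ∀ a b c, (a, b, c) ∈ Omega n → x a b c ≤ tCount n b c a * x 0 a a
  le_b : ∀ a b c, (a, b, c) ∈ Omega n → x a b c ≤ tCount n c a b * x 0 b b
  psd : ∀ k ≤ n / 2,
    (∑ p ∈ Omega n, x p.1 p.2.1 p.2.2 • schrijverT n k p.1 p.2.1 p.2.2).PosSemidef
  psd_compl : ∀ k ≤ n / 2,
    (∑ p ∈ Omega n, ((tCount n p.1 p.2.1 p.2.2 : ℝ) * x 0 p.2.2 p.2.2 - x p.1 p.2.1 p.2.2) •
      schrijverT n k p.1 p.2.1 p.2.2).PosSemidef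
  vanish : ∀ a b c, (a, b, c) ∈ Omega n → (a, b, c) ∈ I → x a b c = 0

/-- The objective function `∑_c x_{0,c,c}`. -/
def sdpObjective (n : ℕ) (x : ℕ → ℕ → ℕ → ℝ) : ℝ :=
  ∑ c ∈ Finset.range (n + 1), x 0 c c

/-- The objective values of the feasible points. -/
def sdpValues (n : ℕ) (I : Set (ℕ × ℕ × ℕ)) : Set ℝ :=
  sdpObjective n '' {x | SDPFeasible n I x}

/-- The optimal value of the program. -/
def sdpOptimum (n : ℕ) (I : Set (ℕ × ℕ × ℕ)) : ℝ := sSup (sdpValues n I)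

/-- The forbidden triples for `d₂(C) ≥ d`. -/
def forbidD (d : ℕ) : Set (ℕ × ℕ × ℕ) :=
  {p | p.1 * p.2.1 * p.2.2 ≠ 0 ∧ (p.1 : ℤ) + p.2.1 + p.2.2 ≤ 2 * ((d : ℤ) - 1)}

/-- The forbidden triples for `r₂(C) ≥ r`. -/
def forbidR (r : ℕ) : Set (ℕ × ℕ × ℕ) :=
  {p | p.1 * p.2.1 * p.2.2 ≠ 0 ∧
    max (max ⌈(p.1 : ℝ) / 2⌉ ⌈(p.2.1 : ℝ) / 2⌉) ⌈(p.2.2 : ℝ) / 2⌉ ≤ (r : ℤ) - 1}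

/-- The forbidden triples for `r̄₂(C) ≥ ρ`. -/
def forbidRbar (ρ : ℝ) : Set (ℕ × ℕ × ℕ) :=
  {p | p.1 * p.2.1 * p.2.2 ≠ 0 ∧ (p.1 : ℝ) + p.2.1 + p.2.2 < 6 * ρ}

/-- The triple-distance distribution of a code: `x_{a,b,c}` is the number of `(x,y,z) ∈ C³` with
`d(y,z) = a`, `d(x,z) = b`, `d(x,y) = c`, divided by `|C|`. -/
def tripleDistribution {n : ℕ} (C : Finset (BinHamming n)) (a b c : ℕ) : ℝ :=
  (1 / (C.card : ℝ)) * (((C ×ˢ C ×ˢ C).filter fun p =>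
    hammingDist p.2.1 p.2.2 = a ∧ hammingDist p.1 p.2.2 = b ∧ hammingDist p.1 p.2.1 = c).card : ℝ)

end

/-! The distance distribution of `C` is itself a feasible point with objective value `|C|`;
compactness then gives the maximum. The substance lies in the two semidefinite constraints.

For a fixed centre `z`, summing `T_k` over all pairs `x, y ∈ C` gives a positive semidefinite matrix
(`posSemidef_sum_schrijverT`). Summing over `z ∈ C` gives (vii). Since `t(a,b,c)` counts all words
at distances `a, b` from the ends of a pair at distance `c`, the coefficients in (viii) count the
triples with `z ∉ C`, so summing over `z ∉ C` gives (viii).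

Positivity for fixed `z` needs no representation theory. By `zonal_eq_rawHahn`, the normalizations
in `T_k` collapse to one scalar, independent of row and column, times the polynomial `rawHahn`. On
subsets of `V` this polynomial defines a kernel `K_k` with `K_0 = 1` and `2 K_{k+1}(V; x, y) =
∑_{a,b} (1_x(a) - 1_x(b)) (1_y(a) - 1_y(b)) K_k(V \ {a,b}; x \ {a,b}, y \ {a,b})`
(`hahnKernel_succ`), so positivity follows by induction on `k`. That `rawHahn` is proportional to
the Hahn polynomial follows from summation by parts (`hahnForm_raise`): the recursion is adjoint to
a difference operator, which lowers degrees.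

The vanishing conditions hold because three distinct words at pairwise distances `a, b, c` satisfy
`2 d ≤ a+b+c`, `6 r̄ ≤ a+b+c`, and `r ≤ ρ` whenever `a, b, c ≤ 2ρ`. -/

open Polynomial

/-! ### Hahn polynomials by a raising recursion -/

/-- The unnormalized Hahn polynomial of degree `k`, built by a raising recursion. -/
noncomputable def rawHahn : ℕ → ℝ → ℝ → ℝ → ℝ[X]
  | 0, _, _, _ => 1
  | k + 1, n, s, t =>
    (C s - X) * (C (n - t) - X) * rawHahn k (n - 2) (s - 1) (t - 1)
      - X * (X + C (t - s)) * (rawHahn k (n - 2) (s - 1) (t - 1)).comp (X - C 1)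

/-- A translation preserves degree and leading coefficient, so the difference loses the top term. -/
theorem degree_sub_comp_X_add_C_lt {k : ℕ} {R : ℝ[X]} (r : ℝ)
    (hR : R.degree < ((k + 1 : ℕ) : WithBot ℕ)) :
    (R - R.comp (X + C r)).degree < (k : WithBot ℕ) := by
  by_cases h0 : R = 0
  · simp [h0]
  have hle : R.degree ≤ (k : WithBot ℕ) := by
    rw [degree_eq_natDegree h0] at hR ⊢
    have : R.natDegree < k + 1 := by exact_mod_cast hR
    exact_mod_cast Nat.lt_succ_iff.mp this
  refine lt_of_lt_of_le (degree_sub_lt_left ?_ h0 ?_) hle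
  · rw [← taylor_apply, degree_taylor]
  · rw [← taylor_apply, leadingCoeff_taylor]

theorem degree_rawHahn (k : ℕ) : ∀ n s t : ℝ,
    (rawHahn k n s t).degree < ((k + 1 : ℕ) : WithBot ℕ) := by
  induction k with
  | zero => intro n s t; simp [rawHahn]
  | succ k ih =>
    intro n s t
    set P := rawHahn k (n - 2) (s - 1) (t - 1) with hP
    have h1 := ih (n - 2) (s - 1) (t - 1)
    rw [← hP] at h1
    have h2 := degree_sub_comp_X_add_C_lt (-1) h1
    have h3 : (P.comp (X - C 1)).degree < ((k + 1 : ℕ) : WithBot ℕ) := by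
      have : P.comp (X - C 1) = taylor (-1) P := by
        rw [taylor_apply]; congr 1; simp [sub_eq_add_neg]
      rw [this, degree_taylor]; exact h1
    -- The recursion seems to raise the degree by two; grouping the `X ^ 2` terms exposes the
    -- difference `P - P(X - 1)`, which gives one degree back.
    have e : rawHahn (k + 1) n s t = C (s * (n - t)) * P + C (-(s + n - t)) * (X * P)
        + X ^ 2 * (P - P.comp (X + C (-1))) + C (-(t - s)) * (X * P.comp (X - C 1)) := by
      rw [rawHahn, ← hP]
      have : (X + C (-1) : ℝ[X]) = X - C 1 := by simp [sub_eq_add_neg]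
      rw [this]
      simp only [C_mul, C_sub, C_neg, C_add]
      ring
    have key : ∀ {A : ℝ[X]} {i j : ℕ}, A.degree < (i : WithBot ℕ) → j + i = k + 2 →
        (X ^ j * A).degree < ((k + 1 + 1 : ℕ) : WithBot ℕ) := by
      intro A i j hA hij
      by_cases h0 : A = 0
      · simp [h0]
      rw [degree_mul, degree_X_pow, degree_eq_natDegree h0]
      rw [degree_eq_natDegree h0] at hA
      have : A.natDegree < i := by exact_mod_cast hA
      have : j + A.natDegree < k + 1 + 1 := by omega
      exact_mod_cast this
    have hC : ∀ (r : ℝ) {A : ℝ[X]}, A.degree < ((k + 1 + 1 : ℕ) : WithBot ℕ) →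
        (C r * A).degree < ((k + 1 + 1 : ℕ) : WithBot ℕ) := by
      intro r A hA
      rw [← smul_eq_C_mul]
      exact (degree_smul_le r A).trans_lt hA
    have hX : ∀ {A : ℝ[X]}, A.degree < ((k + 1 : ℕ) : WithBot ℕ) →
        (X * A).degree < ((k + 1 + 1 : ℕ) : WithBot ℕ) := by
      intro A hA
      simpa using key (j := 1) hA (by omega)
    rw [e, ← mem_degreeLT]
    refine add_mem (add_mem (add_mem ?_ ?_) ?_) ?_ <;> rw [mem_degreeLT]
    · exact hC _ (h1.trans (by exact_mod_cast Nat.lt_succ_self _))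
    · exact hC _ (hX h1)
    · exact key h2 (by omega)
    · exact hC _ (hX h3)

/-- This and `hahnWeight_succ_mul_right` say that each factor of the recursion turns the large
weight into the same multiple of the small one, at `i` or at `i - 1`. This common constant is what
makes the summation by parts close up. -/
theorem hahnWeight_succ_mul_left {n s t i : ℕ} (hst : s ≤ t) (htn : t ≤ n) :
    (hahnWeight (n + 2) (s + 1) (t + 1) i : ℝ) * (((s : ℝ) + 1 - i) * ((n : ℝ) + 2 - (t + 1) - i))
      = (s + 1) * (n - s + 1) * hahnWeight n s t i := by
  obtain ⟨u, rfl⟩ := Nat.exists_eq_add_of_le hst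
  obtain ⟨v, rfl⟩ := Nat.exists_eq_add_of_le htn
  unfold hahnWeight
  rw [show s + u + v + 2 - (s + 1) = u + v + 1 by omega, show s + u + 1 - (s + 1) + i = u + i by omega,
    show s + u + v - s = u + v by omega, show s + u - s + i = u + i by omega]
  have h : ∀ a j : ℕ, ((a + 1).choose j : ℝ) * ((a : ℝ) + 1 - j) = (a + 1) * a.choose j := by
    intro a j
    rcases le_or_gt j (a + 1) with hj | hj
    -- Beyond `j = a + 1` both binomials vanish, so the identity with real subtraction holds for
    -- every `j`.
    · have := Nat.choose_mul_succ_eq a j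
      have h2 : ((a + 1 - j : ℕ) : ℝ) = (a : ℝ) + 1 - j := by push_cast [Nat.cast_sub hj]; ring
      rw [← h2]; rw [mul_comm] at this
      exact_mod_cast this.symm
    · rw [Nat.choose_eq_zero_of_lt hj, Nat.choose_eq_zero_of_lt (by omega : a < j)]; simp
  have h1 := h s i
  have h2 := h (u + v) (u + i)
  push_cast at h2 ⊢
  linear_combination ((u + v + 1).choose (u + i) : ℝ) * (v + 1 - i) * h1
    + (s + 1) * (s.choose i : ℝ) * h2

theorem hahnWeight_succ_mul_right {n s t i : ℕ} (hst : s ≤ t) (htn : t ≤ n) :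
    (hahnWeight (n + 2) (s + 1) (t + 1) (i + 1) : ℝ) * (((i : ℝ) + 1) * ((i : ℝ) + 1 + (t - s)))
      = (s + 1) * (n - s + 1) * hahnWeight n s t i := by
  obtain ⟨u, rfl⟩ := Nat.exists_eq_add_of_le hst
  obtain ⟨v, rfl⟩ := Nat.exists_eq_add_of_le htn
  unfold hahnWeight
  rw [show s + u + v + 2 - (s + 1) = u + v + 1 by omega,
    show s + u + 1 - (s + 1) + (i + 1) = u + i + 1 by omega,
    show s + u + v - s = u + v by omega, show s + u - s + i = u + i by omega]
  have h1 : ((s : ℝ) + 1) * s.choose i = (s + 1).choose (i + 1) * (i + 1) := by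
    exact_mod_cast Nat.add_one_mul_choose_eq s i
  have h2 : ((u : ℝ) + v + 1) * (u + v).choose (u + i)
      = (u + v + 1).choose (u + i + 1) * (u + i + 1) := by
    exact_mod_cast Nat.add_one_mul_choose_eq (u + v) (u + i)
  push_cast at h2 ⊢
  linear_combination -((u + v + 1).choose (u + i + 1) : ℝ) * (u + i + 1) * h1
    - (s + 1) * (s.choose i : ℝ) * h2

/-- Summation by parts for the raising operator. -/
theorem hahnForm_raise {n s t : ℕ} (hst : s ≤ t) (htn : t ≤ n) (P R : ℝ[X]) :
    hahnForm (n + 2) (s + 1) (t + 1)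
      ((C ((s : ℝ) + 1) - X) * (C ((n : ℝ) + 2 - (t + 1)) - X) * P
        - X * (X + C ((t : ℝ) + 1 - (s + 1))) * P.comp (X - C 1)) R
      = (s + 1) * (n - s + 1) * hahnForm n s t P (R - R.comp (X + C 1)) := by
  have hl : ∀ i : ℕ, (hahnWeight (n + 2) (s + 1) (t + 1) i : ℝ) *
      (((s : ℝ) + 1 - i) * ((n : ℝ) + 2 - (t + 1) - i) * P.eval (i : ℝ) * R.eval (i : ℝ))
      = (s + 1) * (n - s + 1) * (hahnWeight n s t i * (P.eval (i : ℝ) * R.eval (i : ℝ))) := by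
    intro i
    linear_combination P.eval (i : ℝ) * R.eval (i : ℝ) * hahnWeight_succ_mul_left (i := i) hst htn
  have hr : ∀ i : ℕ, (hahnWeight (n + 2) (s + 1) (t + 1) (i + 1) : ℝ) *
      (((i : ℝ) + 1) * ((i : ℝ) + 1 + (t - s)) * P.eval (i : ℝ) * R.eval ((i : ℝ) + 1))
      = (s + 1) * (n - s + 1) * (hahnWeight n s t i * (P.eval (i : ℝ) * R.eval ((i : ℝ) + 1))) := by
    intro i
    linear_combination P.eval (i : ℝ) * R.eval ((i : ℝ) + 1) *
      hahnWeight_succ_mul_right (i := i) hst htn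
  have hzero : (hahnWeight n s t (s + 1) : ℝ) = 0 := by simp [hahnWeight]
  unfold hahnForm
  have e : ∀ i : ℕ, (hahnWeight (n + 2) (s + 1) (t + 1) i : ℝ) *
      (eval (i : ℝ) ((C ((s : ℝ) + 1) - X) * (C ((n : ℝ) + 2 - (t + 1)) - X) * P
        - X * (X + C ((t : ℝ) + 1 - (s + 1))) * P.comp (X - C 1)) * eval (i : ℝ) R)
      = (s + 1) * (n - s + 1) * (hahnWeight n s t i * (P.eval (i : ℝ) * R.eval (i : ℝ)))
        - (hahnWeight (n + 2) (s + 1) (t + 1) i : ℝ) *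
          ((i : ℝ) * ((i : ℝ) + (t - s)) * P.eval ((i : ℝ) - 1) * R.eval (i : ℝ)) := by
    intro i
    rw [← hl]
    simp only [eval_sub, eval_mul, eval_add, eval_C, eval_X, eval_comp]
    ring
  -- The first sum loses its top term, where `hahnWeight n s t (s + 1) = 0`; the second loses its
  -- bottom term, killed by the factor `i`. Both then run over the same range.
  rw [Finset.sum_congr rfl fun i _ => e i, Finset.sum_sub_distrib, Finset.sum_range_succ, hzero,
    Finset.sum_range_succ' (fun i : ℕ => (hahnWeight (n + 2) (s + 1) (t + 1) i : ℝ) *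
          ((i : ℝ) * ((i : ℝ) + (t - s)) * P.eval ((i : ℝ) - 1) * R.eval (i : ℝ)))]
  simp only [Nat.cast_add, Nat.cast_one, add_sub_cancel_right, hr, Nat.cast_zero, zero_mul,
    mul_zero, add_zero]
  rw [← Finset.sum_sub_distrib, Finset.mul_sum]
  refine Finset.sum_congr rfl fun i _ => ?_
  simp only [eval_sub, eval_comp, eval_add, eval_X, eval_C]
  ring

/-- Raising is adjoint to `R ↦ R - R(X + 1)`, so each step trades one degree of `k` for one degree
of the test polynomial. -/
theorem hahnForm_rawHahn (k : ℕ) : ∀ {n s t : ℕ}, k ≤ s → s ≤ t → t + k ≤ n → ∀ R : ℝ[X],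
    R.degree < (k : WithBot ℕ) → hahnForm n s t (rawHahn k n s t) R = 0 := by
  induction k with
  | zero =>
    intro n s t _ _ _ R hR
    have : R = 0 := by
      rw [← degree_eq_bot]
      exact Nat.WithBot.lt_zero_iff.mp (by simpa using hR)
    simp [this, hahnForm]
  | succ k ih =>
    intro n s t hs hst ht R hR
    obtain ⟨s, rfl⟩ := Nat.exists_eq_add_of_le' (by omega : 1 ≤ s)
    obtain ⟨t, rfl⟩ := Nat.exists_eq_add_of_le' (by omega : 1 ≤ t)
    obtain ⟨n, rfl⟩ := Nat.exists_eq_add_of_le' (by omega : 2 ≤ n)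
    have h := hahnForm_raise (n := n) (s := s) (t := t) (by omega) (by omega) (rawHahn k n s t) R
    rw [ih (by omega) (by omega) (by omega) _ (degree_sub_comp_X_add_C_lt 1 hR), mul_zero] at h
    rw [← h, rawHahn]
    push_cast
    simp only [add_sub_cancel_right]

/-- At `0` only the first product of the recursion survives and contributes `s (n - t)`. -/
theorem eval_zero_rawHahn (k : ℕ) : ∀ {n s t : ℕ}, k ≤ s → s ≤ t → t + k ≤ n →
    (rawHahn k n s t).eval 0 = (s.descFactorial k * (n - t).descFactorial k : ℕ) := by
  induction k with
  | zero => intro n s t _ _ _; simp [rawHahn]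
  | succ k ih =>
    intro n s t hs hst ht
    obtain ⟨s, rfl⟩ := Nat.exists_eq_add_of_le' (by omega : 1 ≤ s)
    obtain ⟨t, rfl⟩ := Nat.exists_eq_add_of_le' (by omega : 1 ≤ t)
    obtain ⟨n, rfl⟩ := Nat.exists_eq_add_of_le' (by omega : 2 ≤ n)
    have h := ih (n := n) (s := s) (t := t) (by omega) (by omega) (by omega)
    rw [show n + 2 - (t + 1) = (n - t) + 1 by omega, Nat.succ_descFactorial_succ,
      Nat.succ_descFactorial_succ, rawHahn]
    have e : ((n - t : ℕ) : ℝ) = n - t := Nat.cast_sub (by omega)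
    push_cast at h ⊢
    simp only [add_sub_cancel_right, eval_sub, eval_mul, eval_C, eval_X, h, e]
    ring

theorem hahn_eq_rawHahn {n s t k : ℕ} (hks : k ≤ s) (hst : s ≤ t) (htk : t + k ≤ n) :
    hahn n s t k
      = C ((s.descFactorial k * (n - t).descFactorial k : ℕ) : ℝ)⁻¹ * rawHahn k n s t := by
  have hpos : ((s.descFactorial k * (n - t).descFactorial k : ℕ) : ℝ) ≠ 0 := by
    have h1 := Nat.descFactorial_pos.mpr hks
    have h2 := Nat.descFactorial_pos.mpr (by omega : k ≤ n - t)
    exact_mod_cast (Nat.mul_pos h1 h2).ne'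
  refine IsHahn.unique hks hst htk (isHahn_hahn hks hst htk) ?_
  set c := ((s.descFactorial k * (n - t).descFactorial k : ℕ) : ℝ) with hc
  have h0 : (rawHahn k n s t).eval 0 = c := eval_zero_rawHahn k hks hst htk
  have hne : rawHahn k n s t ≠ 0 := by rintro h; rw [h, Polynomial.eval_zero] at h0; exact hpos h0.symm
  refine ⟨?_, ?_, ?_⟩
  · rw [natDegree_C_mul (inv_ne_zero hpos)]
    have h1 : (rawHahn k n s t).natDegree < k + 1 :=
      (natDegree_lt_iff_degree_lt hne).mpr (degree_rawHahn k n s t)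
    -- If the degree dropped, the polynomial would be orthogonal to itself, hence zero, against its
    -- nonzero value at `0`.
    by_contra hlt
    have h2 : (rawHahn k n s t).degree < (k : WithBot ℕ) :=
      (natDegree_lt_iff_degree_lt hne).mp (by omega)
    exact hne (hahnForm_self hks hst htk (degree_rawHahn k n s t)
      (hahnForm_rawHahn k hks hst htk _ h2))
  · intro R hR
    have h := hahnForm_rawHahn k hks hst htk R hR
    have : hahnForm n s t (C c⁻¹ * rawHahn k n s t) R = c⁻¹ * hahnForm n s t (rawHahn k n s t) R := by
      simp only [hahnForm, Finset.mul_sum, eval_mul, eval_C]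
      exact Finset.sum_congr rfl fun i _ => by ring
    rw [this, h, mul_zero]
  · rw [eval_mul, eval_C, h0, inv_mul_cancel₀ hpos]

/-- The falling factorials that normalize the Hahn polynomial cancel against the binomials. The
remaining factor does not depend on `s, t`, so all entries of `T_k` share it. -/
theorem zonal_eq_rawHahn {n s t k : ℕ} (hks : k ≤ s) (hst : s ≤ t) (htk : t + k ≤ n) (m : ℝ) :
    zonal n k s t m
      = 2 ^ n * ((n - 2 * k).factorial / n.factorial) * (rawHahn k n s t).eval (s - m) := by
  unfold zonal
  rw [hahn_eq_rawHahn hks hst htk, eval_mul, eval_C]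
  obtain ⟨s, rfl⟩ := Nat.exists_eq_add_of_le' hks
  obtain ⟨u, rfl⟩ := Nat.exists_eq_add_of_le hst
  obtain ⟨v, rfl⟩ := Nat.exists_eq_add_of_le htk
  have h1 : ∀ a b : ℕ, ((a + b).choose a : ℝ) = (a + b).factorial / (a.factorial * b.factorial) :=
    fun a b => Nat.cast_add_choose ℝ
  have h2 : ∀ a b : ℕ, ((a + b).descFactorial b : ℝ) = (a + b).factorial / a.factorial := by
    intro a b
    rw [eq_div_iff (by positivity)]
    have := Nat.factorial_mul_descFactorial (n := a + b) (k := b) (by omega)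
    rw [Nat.add_sub_cancel, mul_comm] at this
    exact_mod_cast this
  have e1 := h1 s u
  have e2 := h1 (s + u) v
  have e3 := h1 (s + k + u) (k + v)
  have e4 := h1 (s + k) u
  have e5 := h2 s k
  have e6 := h2 v k
  rw [show s + k + u - k = s + u by omega, show s + k - k = s by omega,
    show s + k + u + k + v - 2 * k = s + u + v by omega,
    show s + k + u + k + v - (s + k + u) = v + k by omega,
    show s + k + u + k + v = s + k + u + (k + v) by omega, Nat.cast_mul, e1, e2, e3, e4, e5, e6]
  rw [show k + v = v + k by omega]
  field_simp

/-- In terms of the intersection size `m`, the factors of the recursion are `m (n - s - t + m)` and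
`(s - m)(t - m)`, symmetric in `s` and `t`. This identifies the two branches of `schrijverT` and
makes the matrices symmetric. -/
theorem eval_rawHahn_comm (k : ℕ) : ∀ n s t m : ℝ,
    (rawHahn k n s t).eval (s - m) = (rawHahn k n t s).eval (t - m) := by
  induction k with
  | zero => intro n s t m; simp [rawHahn]
  | succ k ih =>
    intro n s t m
    have h1 := ih (n - 2) (s - 1) (t - 1) (m - 1)
    have h2 := ih (n - 2) (s - 1) (t - 1) m
    rw [show s - 1 - (m - 1) = s - m by ring, show t - 1 - (m - 1) = t - m by ring] at h1
    rw [show s - 1 - m = s - m - 1 by ring, show t - 1 - m = t - m - 1 by ring] at h2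
    simp only [rawHahn, eval_sub, eval_mul, eval_add, eval_C, eval_X, eval_comp, h1, h2]
    ring

/-! ### Positivity of the Hahn kernels -/

section Kernel

variable {α : Type*} [DecidableEq α]

/-- The zonal kernel of the unnormalized Hahn polynomials on the subsets of `V`. -/
noncomputable def hahnKernel (k : ℕ) (V x y : Finset α) : ℝ :=
  (rawHahn k V.card x.card y.card).eval ((x.card : ℝ) - (x ∩ y).card)

/-- The real-valued indicator of a finite set. -/
noncomputable def finsetInd (S : Finset α) (a : α) : ℝ := if a ∈ S then 1 else 0

theorem sum_finsetInd {V S : Finset α} (h : S ⊆ V) : ∑ a ∈ V, finsetInd S a = S.card := by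
  simp [finsetInd, Finset.inter_eq_right.mpr h]

theorem cast_card_sdiff_pair {S : Finset α} {a b : α} (hab : a ≠ b) :
    ((S \ {a, b}).card : ℝ) = S.card - finsetInd S a - finsetInd S b := by
  have h1 : (S \ {a, b}) = (S.erase a).erase b := by
    ext c; simp only [Finset.mem_sdiff, Finset.mem_insert, Finset.mem_singleton, Finset.mem_erase]; tauto
  have h2 : ∀ (T : Finset α) (c : α), ((T.erase c).card : ℝ) = T.card - finsetInd T c := by
    intro T c
    unfold finsetInd
    split_ifs with h
    · have := Finset.card_erase_add_one h
      rw [eq_sub_iff_add_eq]; exact_mod_cast this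
    · simp [Finset.erase_eq_of_notMem h]
  rw [h1, h2, h2]
  congr 1
  simp [finsetInd, hab.symm]

/-- At `X = |x \ y|` the four factors of the recursion are the sizes of `x ∩ y`, `V \ (x ∪ y)`, `x \
y` and `y \ x`, so the recursion counts pairs of points. The `2` comes from ordered pairs. -/
theorem hahnKernel_succ (k : ℕ) {V x y : Finset α} (hx : x ⊆ V) (hy : y ⊆ V) :
    ∑ a ∈ V, ∑ b ∈ V, (finsetInd x a - finsetInd x b) * (finsetInd y a - finsetInd y b) *
      hahnKernel k (V \ {a, b}) (x \ {a, b}) (y \ {a, b}) = 2 * hahnKernel (k + 1) V x y := by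
  set P := rawHahn k (V.card - 2) (x.card - 1) (y.card - 1) with hP
  set A := P.eval ((x.card : ℝ) - (x ∩ y).card) with hA
  set B := P.eval ((x.card : ℝ) - (x ∩ y).card - 1) with hB
  set p := finsetInd (x ∩ y) with hp
  set q := finsetInd (V \ (x ∪ y)) with hq
  set r := finsetInd (x \ y) with hr
  set u := finsetInd (y \ x) with hu
  -- The product of differences is nonzero only if both `x` and `y` separate `a` from `b`. Either
  -- one point is in `x ∩ y` and the other outside `x ∪ y` (sign `+`, `|x \ y|` unchanged, value
  -- `A`), or one is in `x \ y` and the other in `y \ x` (sign `-`, `|x \ y|` drops by one, value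
  -- `B`).
  have key : ∀ a ∈ V, ∀ b ∈ V,
      (finsetInd x a - finsetInd x b) * (finsetInd y a - finsetInd y b) *
        hahnKernel k (V \ {a, b}) (x \ {a, b}) (y \ {a, b})
      = A * (p a * q b + q a * p b) - B * (r a * u b + u a * r b) := by
    intro a ha b hb
    by_cases hab : a = b
    · subst hab
      by_cases h1 : a ∈ x <;> by_cases h2 : a ∈ y <;>
        simp [hp, hq, hr, hu, finsetInd, h1, h2]
    have hK : hahnKernel k (V \ {a, b}) (x \ {a, b}) (y \ {a, b})
        = (rawHahn k (V.card - 2) (x.card - finsetInd x a - finsetInd x b)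
            (y.card - finsetInd y a - finsetInd y b)).eval
            ((x.card - finsetInd x a - finsetInd x b)
              - ((x ∩ y).card - p a - p b)) := by
      unfold hahnKernel
      have : x \ {a, b} ∩ (y \ {a, b}) = (x ∩ y) \ {a, b} := by
        ext c; simp only [Finset.mem_inter, Finset.mem_sdiff]; tauto
      rw [this]
      simp only [cast_card_sdiff_pair hab]
      simp only [finsetInd, ha, hb, hp]
      norm_num [sub_sub, one_add_one_eq_two]
    rw [hK]
    have e1 : ∀ w z : ℝ, w - 1 - (z - 1) = w - z := fun w z => by ring
    have e2 : ∀ w z : ℝ, w - 1 - z = w - z - 1 := fun w z => by ring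
    by_cases h1 : a ∈ x <;> by_cases h2 : a ∈ y <;> by_cases h3 : b ∈ x <;>
      by_cases h4 : b ∈ y <;>
      simp [hp, hq, hr, hu, finsetInd, h1, h2, h3, h4, ha, hb, hA, hB, hP, e1] <;>
      rw [e2]
  rw [Finset.sum_congr rfl fun a ha => Finset.sum_congr rfl fun b hb => key a ha b hb]
  have sp : ∑ a ∈ V, p a = (x ∩ y).card := sum_finsetInd (Finset.inter_subset_left.trans hx)
  have sr : ∑ a ∈ V, r a = x.card - (x ∩ y).card := by
    rw [hr, sum_finsetInd (Finset.sdiff_subset.trans hx), eq_sub_iff_add_eq]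
    exact_mod_cast Finset.card_sdiff_add_card_inter x y
  have su : ∑ a ∈ V, u a = y.card - (x ∩ y).card := by
    rw [hu, sum_finsetInd (Finset.sdiff_subset.trans hy), eq_sub_iff_add_eq, Finset.inter_comm]
    exact_mod_cast Finset.card_sdiff_add_card_inter y x
  have sq : ∑ a ∈ V, q a = V.card - x.card - y.card + (x ∩ y).card := by
    rw [hq, sum_finsetInd Finset.sdiff_subset]
    have h1 : ((V \ (x ∪ y)).card : ℝ) + (x ∪ y).card = V.card := by
      exact_mod_cast Finset.card_sdiff_add_card_eq_card (Finset.union_subset hx hy)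
    have h2 : ((x ∪ y).card : ℝ) + (x ∩ y).card = x.card + y.card := by
      exact_mod_cast Finset.card_union_add_card_inter x y
    linarith
  simp only [Finset.sum_sub_distrib, ← Finset.mul_sum, Finset.sum_add_distrib, ← Finset.sum_mul,
    sp, sq, sr, su]
  unfold hahnKernel
  simp only [rawHahn, eval_sub, eval_mul, eval_add, eval_C, eval_X, eval_comp, ← hP, ← hA, ← hB]
  ring

/-- For each pair `a, b` the recursion absorbs the differences of indicators into the coefficients
`c i`, leaving a form of order `k` on `V \ {a, b}`. The family is indexed because distinct sets may
coincide once `a, b` are removed. -/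
theorem hahnKernel_nonneg {ι : Type*} (I : Finset ι) (k : ℕ) :
    ∀ (V : Finset α) (x : ι → Finset α) (c : ι → ℝ), (∀ i ∈ I, x i ⊆ V) →
      0 ≤ ∑ i ∈ I, ∑ j ∈ I, c i * c j * hahnKernel k V (x i) (x j) := by
  induction k with
  | zero =>
    intro V x c _
    simp only [hahnKernel, rawHahn, eval_one, mul_one, ← Finset.mul_sum, ← Finset.sum_mul]
    exact mul_self_nonneg _
  | succ k ih =>
    intro V x c hx
    have key : 2 * ∑ i ∈ I, ∑ j ∈ I, c i * c j * hahnKernel (k + 1) V (x i) (x j)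
        = ∑ a ∈ V, ∑ b ∈ V, ∑ i ∈ I, ∑ j ∈ I,
          (c i * (finsetInd (x i) a - finsetInd (x i) b)) *
            (c j * (finsetInd (x j) a - finsetInd (x j) b)) *
            hahnKernel k (V \ {a, b}) (x i \ {a, b}) (x j \ {a, b}) := by
      have h : ∀ i ∈ I, ∀ j ∈ I, 2 * (c i * c j * hahnKernel (k + 1) V (x i) (x j))
          = ∑ a ∈ V, ∑ b ∈ V, (c i * (finsetInd (x i) a - finsetInd (x i) b)) *
            (c j * (finsetInd (x j) a - finsetInd (x j) b)) *
            hahnKernel k (V \ {a, b}) (x i \ {a, b}) (x j \ {a, b}) := by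
        intro i hi j hj
        rw [mul_left_comm, ← hahnKernel_succ k (hx i hi) (hx j hj)]
        simp only [Finset.mul_sum]
        exact Finset.sum_congr rfl fun a _ => Finset.sum_congr rfl fun b _ => by ring
      simp only [Finset.mul_sum]
      rw [Finset.sum_congr rfl fun i hi => Finset.sum_congr rfl fun j hj => h i hi j hj]
      rw [Finset.sum_congr rfl fun i _ => Finset.sum_comm, Finset.sum_comm]
      refine Finset.sum_congr rfl fun a _ => ?_
      rw [Finset.sum_congr rfl fun i _ => Finset.sum_comm, Finset.sum_comm]
    have hnn : 0 ≤ 2 * ∑ i ∈ I, ∑ j ∈ I, c i * c j * hahnKernel (k + 1) V (x i) (x j) := by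
      rw [key]
      exact Finset.sum_nonneg fun a _ => Finset.sum_nonneg fun b _ =>
        ih (V \ {a, b}) (fun i => x i \ {a, b}) _
          fun i hi => Finset.sdiff_subset_sdiff (hx i hi) subset_rfl
    linarith

end Kernel

/-! ### Distances of triples and the matrices `T_k` -/

section TripleCount

variable {n : ℕ}

/-- The set of coordinates where two words differ. -/
def diffSet (x z : BinHamming n) : Finset (Fin n) := Finset.univ.filter fun j => x j ≠ z j

theorem card_diffSet (x z : BinHamming n) : (diffSet x z).card = hammingDist x z := rfl

theorem diffSet_eq_symmDiff (x y z : BinHamming n) :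
    diffSet x y = (diffSet x z \ diffSet y z) ∪ (diffSet y z \ diffSet x z) := by
  ext j
  simp only [diffSet, Finset.mem_union, Finset.mem_sdiff, Finset.mem_filter, Finset.mem_univ,
    true_and, not_not]
  generalize x j = u; generalize y j = v; generalize z j = w
  revert u v w; decide

theorem hammingDist_add_two_mul_inter (x y z : BinHamming n) :
    hammingDist x y + 2 * (diffSet x z ∩ diffSet y z).card
      = hammingDist x z + hammingDist y z := by
  have h1 := Finset.card_sdiff_add_card_inter (diffSet x z) (diffSet y z)
  have h2 := Finset.card_sdiff_add_card_inter (diffSet y z) (diffSet x z)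
  have h3 : hammingDist x y = (diffSet x z \ diffSet y z).card + (diffSet y z \ diffSet x z).card := by
    rw [← card_diffSet, diffSet_eq_symmDiff x y z, Finset.card_union_of_disjoint]
    exact disjoint_sdiff_sdiff
  rw [Finset.inter_comm] at h2
  rw [card_diffSet] at h1 h2
  omega

theorem hammingDist_triple_mem_Omega (x y z : BinHamming n) :
    (hammingDist y z, hammingDist x z, hammingDist x y) ∈ Omega n := by
  have hn : ∀ u v : BinHamming n, hammingDist u v ≤ n := fun u v => by
    simpa using hammingDist_le_card_fintype (x := u) (y := v)
  have h := hammingDist_add_two_mul_inter x y z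
  have h1 := Finset.card_union_add_card_inter (diffSet x z) (diffSet y z)
  have h2 : (diffSet x z ∪ diffSet y z).card ≤ n := by
    simpa using Finset.card_le_univ (diffSet x z ∪ diffSet y z)
  have h3 := hammingDist_triangle y x z
  have h4 := hammingDist_triangle x y z
  rw [hammingDist_comm y x] at h3
  rw [card_diffSet, card_diffSet] at h1
  have := hn x y
  have := hn x z
  have := hn y z
  simp only [Omega, Finset.mem_filter, Finset.mem_product, Finset.mem_range]
  omega

/-- The positive factor relating the zonal functions to the kernels `hahnKernel`. -/
noncomputable def zonalFactor (n k : ℕ) : ℝ := 2 ^ n * ((n - 2 * k).factorial / n.factorial)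

theorem zonalFactor_nonneg (n k : ℕ) : 0 ≤ zonalFactor n k := by
  unfold zonalFactor; positivity

theorem hahnKernel_comm {α : Type*} [DecidableEq α] (k : ℕ) (V x y : Finset α) :
    hahnKernel k V x y = hahnKernel k V y x := by
  unfold hahnKernel
  rw [eval_rawHahn_comm, Finset.inter_comm]

theorem schrijverT_apply (k : ℕ) (x y z : BinHamming n) (s t : Finset.Icc k (n - k)) :
    schrijverT n k (hammingDist y z) (hammingDist x z) (hammingDist x y) s t
      = if s.1 = hammingDist x z ∧ t.1 = hammingDist y z then
          zonalFactor n k * hahnKernel k Finset.univ (diffSet x z) (diffSet y z) else 0 := by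
  unfold schrijverT
  rw [Matrix.of_apply]
  split_ifs with h hle
  · have hs := Finset.mem_Icc.mp s.2
    have ht := Finset.mem_Icc.mp t.2
    have hm : ((hammingDist y z : ℝ) + hammingDist x z - hammingDist x y) / 2
        = (diffSet x z ∩ diffSet y z).card := by
      have : (hammingDist x y : ℝ) + 2 * (diffSet x z ∩ diffSet y z).card
          = hammingDist x z + hammingDist y z := by
        exact_mod_cast hammingDist_add_two_mul_inter x y z
      linarith
    rw [hm, zonal_eq_rawHahn hs.1 hle (by omega), h.1, h.2]
    simp only [hahnKernel, zonalFactor, card_diffSet, Finset.card_univ, Fintype.card_fin]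
  · have hs := Finset.mem_Icc.mp s.2
    have ht := Finset.mem_Icc.mp t.2
    have hm : ((hammingDist y z : ℝ) + hammingDist x z - hammingDist x y) / 2
        = (diffSet x z ∩ diffSet y z).card := by
      have : (hammingDist x y : ℝ) + 2 * (diffSet x z ∩ diffSet y z).card
          = hammingDist x z + hammingDist y z := by
        exact_mod_cast hammingDist_add_two_mul_inter x y z
      linarith
    rw [hm, zonal_eq_rawHahn ht.1 (by omega) (by omega), h.1, h.2, eval_rawHahn_comm]
    simp only [hahnKernel, zonalFactor, card_diffSet, Finset.card_univ, Fintype.card_fin]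
  · rfl

/-- The quadratic form is a nonnegative multiple of the kernel form on the sets `diffSet x z`. -/
theorem posSemidef_sum_schrijverT (k : ℕ) (C : Finset (BinHamming n)) (z : BinHamming n) :
    (∑ x ∈ C, ∑ y ∈ C,
      schrijverT n k (hammingDist y z) (hammingDist x z) (hammingDist x y)).PosSemidef := by
  rw [Matrix.posSemidef_iff_dotProduct_mulVec]
  constructor
  · ext s t
    simp only [Matrix.conjTranspose_apply, Matrix.sum_apply, star_trivial, schrijverT_apply]
    rw [Finset.sum_comm]
    refine Finset.sum_congr rfl fun x _ => Finset.sum_congr rfl fun y _ => ?_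
    rw [hahnKernel_comm]
    exact if_congr and_comm rfl rfl
  · intro v
    -- The entry of `v` at index `d(x,z)`, or `0` if that weight is outside `{k, …, n-k}`.
    set w : BinHamming n → ℝ := fun x =>
      ∑ s : Finset.Icc k (n - k), if s.1 = hammingDist x z then v s else 0 with hw
    have key : star v ⬝ᵥ (∑ x ∈ C, ∑ y ∈ C,
        schrijverT n k (hammingDist y z) (hammingDist x z) (hammingDist x y)).mulVec v
        = zonalFactor n k * ∑ x ∈ C, ∑ y ∈ C,
          w x * w y * hahnKernel k Finset.univ (diffSet x z) (diffSet y z) := by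
      simp only [Matrix.sum_mulVec, dotProduct_sum]
      simp only [Finset.mul_sum]
      refine Finset.sum_congr rfl fun x _ => Finset.sum_congr rfl fun y _ => ?_
      simp only [dotProduct, Matrix.mulVec, schrijverT_apply, hw, Finset.sum_mul, Finset.mul_sum]
      rw [Finset.sum_comm]
      refine Finset.sum_congr rfl fun s _ => Finset.sum_congr rfl fun t _ => ?_
      by_cases h1 : s.1 = hammingDist y z <;> by_cases h2 : t.1 = hammingDist x z <;>
        simp [h1, h2]
      ring
    rw [key]
    exact mul_nonneg (zonalFactor_nonneg n k)
      (hahnKernel_nonneg C k Finset.univ _ w fun _ _ => Finset.subset_univ _)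

/-! ### Counting triples; feasibility of the distance distribution -/

/-- The number of triples `(x, y, z) ∈ C × C × Z` with the given distances. -/
def tripleCount (C Z : Finset (BinHamming n)) (a b c : ℕ) : ℕ :=
  ((C ×ˢ C ×ˢ Z).filter fun p =>
    hammingDist p.2.1 p.2.2 = a ∧ hammingDist p.1 p.2.2 = b ∧ hammingDist p.1 p.2.1 = c).card

theorem tripleDistribution_eq (C : Finset (BinHamming n)) (a b c : ℕ) :
    tripleDistribution C a b c = (1 / (C.card : ℝ)) * tripleCount C C a b c := rfl

theorem tripleCount_eq_sum (C Z : Finset (BinHamming n)) (a b c : ℕ) :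
    tripleCount C Z a b c = ∑ x ∈ C, ∑ y ∈ C, ∑ z ∈ Z,
      if hammingDist y z = a ∧ hammingDist x z = b ∧ hammingDist x y = c then 1 else 0 := by
  simp only [tripleCount, Finset.card_filter, Finset.sum_product]

/-- Triples are grouped by their distances; all of these lie in `Omega n`, so none is lost. -/
theorem sum_tripleCount_smul {M : Type*} [AddCommGroup M] [Module ℝ M]
    (C Z : Finset (BinHamming n)) (T : ℕ → ℕ → ℕ → M) :
    ∑ p ∈ Omega n, (tripleCount C Z p.1 p.2.1 p.2.2 : ℝ) • T p.1 p.2.1 p.2.2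
      = ∑ z ∈ Z, ∑ x ∈ C, ∑ y ∈ C, T (hammingDist y z) (hammingDist x z) (hammingDist x y) := by
  have h : ∀ p ∈ Omega n, (tripleCount C Z p.1 p.2.1 p.2.2 : ℝ) • T p.1 p.2.1 p.2.2
      = ∑ z ∈ Z, ∑ x ∈ C, ∑ y ∈ C,
        if p = (hammingDist y z, hammingDist x z, hammingDist x y) then
          T (hammingDist y z) (hammingDist x z) (hammingDist x y) else 0 := by
    rintro ⟨a, b, c⟩ _
    rw [tripleCount_eq_sum]
    push_cast
    simp only [Finset.sum_smul]
    rw [Finset.sum_congr rfl fun x _ => Finset.sum_comm, Finset.sum_comm]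
    refine Finset.sum_congr rfl fun z _ => Finset.sum_congr rfl fun x _ =>
      Finset.sum_congr rfl fun y _ => ?_
    by_cases h : hammingDist y z = a ∧ hammingDist x z = b ∧ hammingDist x y = c
    · obtain ⟨rfl, rfl, rfl⟩ := h
      simp
    · rw [if_neg h, if_neg, zero_smul]
      rintro h'
      simp only [Prod.mk.injEq] at h'
      exact h ⟨h'.1.symm, h'.2.1.symm, h'.2.2.symm⟩
  rw [Finset.sum_congr rfl h, Finset.sum_comm]
  refine Finset.sum_congr rfl fun z _ => ?_
  rw [Finset.sum_comm]
  refine Finset.sum_congr rfl fun x _ => ?_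
  rw [Finset.sum_comm]
  refine Finset.sum_congr rfl fun y _ => ?_
  rw [Finset.sum_ite_eq' (Omega n)]
  exact if_pos (hammingDist_triple_mem_Omega x y z)

theorem posSemidef_sum_tripleCount (k : ℕ) (C Z : Finset (BinHamming n)) :
    (∑ p ∈ Omega n, (tripleCount C Z p.1 p.2.1 p.2.2 : ℝ) •
      schrijverT n k p.1 p.2.1 p.2.2).PosSemidef := by
  rw [sum_tripleCount_smul C Z (schrijverT n k)]
  exact Matrix.posSemidef_sum _ fun z _ => posSemidef_sum_schrijverT k C z

theorem tripleCount_swap_left (C : Finset (BinHamming n)) (a b c : ℕ) :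
    tripleCount C C a b c = tripleCount C C b a c := by
  rw [tripleCount_eq_sum, tripleCount_eq_sum, Finset.sum_comm]
  refine Finset.sum_congr rfl fun x _ => Finset.sum_congr rfl fun y _ =>
    Finset.sum_congr rfl fun z _ => if_congr ?_ rfl rfl
  rw [hammingDist_comm y x]
  tauto

theorem tripleCount_swap_right (C : Finset (BinHamming n)) (a b c : ℕ) :
    tripleCount C C a b c = tripleCount C C a c b := by
  rw [tripleCount_eq_sum, tripleCount_eq_sum]
  refine Finset.sum_congr rfl fun x _ => ?_
  rw [Finset.sum_comm]
  refine Finset.sum_congr rfl fun y _ =>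
    Finset.sum_congr rfl fun z _ => if_congr ?_ rfl rfl
  rw [hammingDist_comm z y]
  tauto

theorem tripleCount_pair (C : Finset (BinHamming n)) (c : ℕ) :
    tripleCount C C 0 c c = ∑ x ∈ C, ∑ y ∈ C, if hammingDist x y = c then 1 else 0 := by
  rw [tripleCount_eq_sum]
  refine Finset.sum_congr rfl fun x _ => Finset.sum_congr rfl fun y hy => ?_
  rw [Finset.sum_eq_single_of_mem y hy]
  · simp
  · intro z _ hz
    rw [if_neg]
    rintro ⟨h, -⟩
    exact hz (hammingDist_eq_zero.mp h).symm

/-- `tCount` counts the words at prescribed distances from two given words. -/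
theorem card_filter_hammingDist (x y : BinHamming n) {a b : ℕ}
    (h : (a, b, hammingDist x y) ∈ Omega n) :
    (Finset.univ.filter fun z : BinHamming n => hammingDist y z = a ∧ hammingDist x z = b).card
      = tCount n a b (hammingDist x y) := by
  simp only [Omega, Finset.mem_filter, Finset.mem_product, Finset.mem_range] at h
  set c := hammingDist x y with hc
  -- The number of coordinates of `diffSet x y` in which `z` differs from `y`. Parity and the
  -- triangle inequalities in `Omega` make the division and both natural subtractions exact.
  set i := (a + c - b) / 2 with hi
  have hD : (diffSet x y).card = c := rfl
  have hDc : (diffSet x y)ᶜ.card = n - c := by rw [Finset.card_compl, hD]; simp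
  have hcard : tCount n a b c
      = ((diffSet x y).powersetCard i ×ˢ (diffSet x y)ᶜ.powersetCard (a - i)).card := by
    rw [Finset.card_product, Finset.card_powersetCard, Finset.card_powersetCard, hD, hDc]
    rfl
  rw [hcard]
  have hsplit : ∀ z : BinHamming n, (diffSet z y ∩ diffSet x y).card + (diffSet z y \ diffSet x y).card
      = hammingDist y z := by
    intro z
    rw [Finset.card_inter_add_card_sdiff, card_diffSet, hammingDist_comm]
  have hdist : ∀ z : BinHamming n,
      hammingDist x z + 2 * (diffSet z y ∩ diffSet x y).card = c + hammingDist y z := by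
    intro z
    have := hammingDist_add_two_mul_inter z x y
    rw [hammingDist_comm z x, hammingDist_comm z y] at this
    omega
  have hflip : ∀ S : Finset (Fin n), diffSet (fun j => if j ∈ S then y j + 1 else y j) y = S := by
    intro S
    ext j
    simp only [diffSet, Finset.mem_filter, Finset.mem_univ, true_and]
    split_ifs with hj <;> simp [hj]
  -- A word `z` corresponds to the coordinates where it differs from `y`, split into those inside
  -- and outside `diffSet x y`; the inverse flips `y` there.
  refine Finset.card_nbij' (fun z => (diffSet z y ∩ diffSet x y, diffSet z y \ diffSet x y))
    (fun S j => if j ∈ S.1 ∪ S.2 then y j + 1 else y j) ?_ ?_ ?_ ?_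
  · intro z hz
    simp only [Finset.coe_filter, Finset.mem_univ, true_and, Set.mem_ofPred_eq] at hz
    have h1 := hsplit z
    have h2 := hdist z
    rw [hz.1] at h1 h2
    rw [hz.2] at h2
    simp only [Finset.coe_product, Set.mem_prod, Finset.mem_coe, Finset.mem_powersetCard]
    refine ⟨⟨Finset.inter_subset_right, by omega⟩, ?_, by omega⟩
    intro j hj
    rw [Finset.mem_compl]
    exact (Finset.mem_sdiff.mp hj).2
  · rintro ⟨S, R⟩ hSR
    simp only [Finset.coe_product, Set.mem_prod, Finset.mem_coe, Finset.mem_powersetCard] at hSR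
    obtain ⟨⟨hS, hSc⟩, hR, hRc⟩ := hSR
    have h1 := hsplit (fun j => if j ∈ S ∪ R then y j + 1 else y j)
    have h2 := hdist (fun j => if j ∈ S ∪ R then y j + 1 else y j)
    have hRd : Disjoint R (diffSet x y) := by
      rw [Finset.disjoint_left]; intro j hj; exact Finset.mem_compl.mp (hR hj)
    have e1 : (S ∪ R) ∩ diffSet x y = S := by
      rw [Finset.union_inter_distrib_right, Finset.inter_eq_left.mpr hS,
        Finset.disjoint_iff_inter_eq_empty.mp hRd, Finset.union_empty]
    have e2 : (S ∪ R) \ diffSet x y = R := by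
      rw [Finset.union_sdiff_distrib, Finset.sdiff_eq_empty_iff_subset.mpr hS,
        Finset.sdiff_eq_self_of_disjoint hRd, Finset.empty_union]
    rw [hflip, e1] at h2
    rw [hflip, e1, e2] at h1
    simp only [Finset.coe_filter, Finset.mem_univ, true_and, Set.mem_ofPred_eq]
    omega
  · intro z _
    funext j
    have : diffSet z y ∩ diffSet x y ∪ diffSet z y \ diffSet x y = diffSet z y := by
      rw [Finset.union_comm]; exact Finset.sdiff_union_inter _ _
    simp only [this]
    simp only [diffSet, Finset.mem_filter, Finset.mem_univ, true_and]
    generalize z j = u; generalize y j = v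
    revert u v; decide
  · rintro ⟨S, R⟩ hSR
    simp only [Finset.coe_product, Set.mem_prod, Finset.mem_coe, Finset.mem_powersetCard] at hSR
    obtain ⟨⟨hS, hSc⟩, hR, hRc⟩ := hSR
    have hRd : Disjoint R (diffSet x y) := by
      rw [Finset.disjoint_left]; intro j hj; exact Finset.mem_compl.mp (hR hj)
    simp only [hflip]
    rw [Finset.union_inter_distrib_right, Finset.inter_eq_left.mpr hS,
        Finset.disjoint_iff_inter_eq_empty.mp hRd, Finset.union_empty,
        Finset.union_sdiff_distrib, Finset.sdiff_eq_empty_iff_subset.mpr hS,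
        Finset.sdiff_eq_self_of_disjoint hRd, Finset.empty_union]

theorem tripleCount_univ (C : Finset (BinHamming n)) {a b c : ℕ} (h : (a, b, c) ∈ Omega n) :
    tripleCount C Finset.univ a b c = tCount n a b c * tripleCount C C 0 c c := by
  rw [tripleCount_pair, tripleCount_eq_sum, Finset.mul_sum]
  refine Finset.sum_congr rfl fun x _ => ?_
  rw [Finset.mul_sum]
  refine Finset.sum_congr rfl fun y _ => ?_
  by_cases hc : hammingDist x y = c
  · subst hc
    rw [← card_filter_hammingDist x y h, Finset.card_filter]
    simp
  · simp [hc]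

theorem tripleCount_add_compl (C : Finset (BinHamming n)) (a b c : ℕ) :
    tripleCount C C a b c + tripleCount C Cᶜ a b c = tripleCount C Finset.univ a b c := by
  simp only [tripleCount_eq_sum, ← Finset.sum_add_distrib]
  exact Finset.sum_congr rfl fun x _ => Finset.sum_congr rfl fun y _ =>
    Finset.sum_add_sum_compl C _

/-- The slack in (iv) counts triples with `z ∉ C`: this yields both (iv) and (viii). -/
theorem tCount_mul_tripleDistribution (C : Finset (BinHamming n)) {a b c : ℕ}
    (h : (a, b, c) ∈ Omega n) :
    (tCount n a b c : ℝ) * tripleDistribution C 0 c c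
      = tripleDistribution C a b c + (1 / (C.card : ℝ)) * tripleCount C Cᶜ a b c := by
  have h1 : (tripleCount C C a b c : ℝ) + tripleCount C Cᶜ a b c
      = tCount n a b c * tripleCount C C 0 c c := by
    exact_mod_cast (tripleCount_add_compl C a b c).trans (tripleCount_univ C h)
  rw [tripleDistribution_eq, tripleDistribution_eq]
  linear_combination -(1 / (C.card : ℝ)) * h1

theorem tripleDistribution_swap_left (C : Finset (BinHamming n)) (a b c : ℕ) :
    tripleDistribution C a b c = tripleDistribution C b a c := by
  rw [tripleDistribution_eq, tripleDistribution_eq, tripleCount_swap_left]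

theorem tripleDistribution_swap_right (C : Finset (BinHamming n)) (a b c : ℕ) :
    tripleDistribution C a b c = tripleDistribution C a c b := by
  rw [tripleDistribution_eq, tripleDistribution_eq, tripleCount_swap_right]

theorem tripleDistribution_le (C : Finset (BinHamming n)) {a b c : ℕ} (h : (a, b, c) ∈ Omega n) :
    tripleDistribution C a b c ≤ tCount n a b c * tripleDistribution C 0 c c := by
  rw [tCount_mul_tripleDistribution C h]
  exact le_add_of_nonneg_right (by positivity)

theorem tripleDistribution_eq_zero (C : Finset (BinHamming n)) {a b c : ℕ}
    (h : ∀ x ∈ C, ∀ y ∈ C, ∀ z ∈ C,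
      ¬(hammingDist y z = a ∧ hammingDist x z = b ∧ hammingDist x y = c)) :
    tripleDistribution C a b c = 0 := by
  rw [tripleDistribution_eq, tripleCount_eq_sum,
    Finset.sum_eq_zero fun x hx => Finset.sum_eq_zero fun y hy => Finset.sum_eq_zero fun z hz =>
      if_neg (h x hx y hy z hz)]
  simp

theorem tripleDistribution_perm (C : Finset (BinHamming n)) (p : Fin 3 → ℕ)
    (τ : Equiv.Perm (Fin 3)) :
    tripleDistribution C (p 0) (p 1) (p 2)
      = tripleDistribution C (p (τ 0)) (p (τ 1)) (p (τ 2)) := by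
  have hτ : ∀ τ : Equiv.Perm (Fin 3), (τ 0 = 0 ∧ τ 1 = 1 ∧ τ 2 = 2) ∨ (τ 0 = 0 ∧ τ 1 = 2 ∧ τ 2 = 1) ∨
      (τ 0 = 1 ∧ τ 1 = 0 ∧ τ 2 = 2) ∨ (τ 0 = 1 ∧ τ 1 = 2 ∧ τ 2 = 0) ∨
      (τ 0 = 2 ∧ τ 1 = 0 ∧ τ 2 = 1) ∨ (τ 0 = 2 ∧ τ 1 = 1 ∧ τ 2 = 0) := by decide
  have hl := tripleDistribution_swap_left C
  have hr := tripleDistribution_swap_right C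
  rcases hτ τ with ⟨h0, h1, h2⟩ | ⟨h0, h1, h2⟩ | ⟨h0, h1, h2⟩ | ⟨h0, h1, h2⟩ | ⟨h0, h1, h2⟩ |
    ⟨h0, h1, h2⟩ <;> rw [h0, h1, h2]
  · exact hr _ _ _
  · exact hl _ _ _
  · exact (hl _ _ _).trans (hr _ _ _)
  · exact (hr _ _ _).trans (hl _ _ _)
  · exact ((hl _ _ _).trans (hr _ _ _)).trans (hl _ _ _)

theorem mem_Omega_rotate {a b c : ℕ} (h : (a, b, c) ∈ Omega n) : (b, c, a) ∈ Omega n := by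
  simp only [Omega, Finset.mem_filter, Finset.mem_product, Finset.mem_range] at h ⊢
  omega

/-- The triple-distance distribution of a nonempty code satisfies the constraints of the program
that hold for every code. -/
theorem SDPFeasible.tripleDistribution {C : Finset (BinHamming n)} (hC : C.Nonempty)
    {I : Set (ℕ × ℕ × ℕ)}
    (hI : ∀ x ∈ C, ∀ y ∈ C, ∀ z ∈ C,
      (hammingDist y z, hammingDist x z, hammingDist x y) ∉ I) :
    SDPFeasible n I (tripleDistribution C) where
  support a b c h := tripleDistribution_eq_zero C fun x _ y _ z _ ⟨ha, hb, hc⟩ => h <| by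
    rw [← ha, ← hb, ← hc]; exact hammingDist_triple_mem_Omega x y z
  normalized := by
    rw [tripleDistribution_eq, tripleCount_pair]
    have : (C.card : ℝ) ≠ 0 := by exact_mod_cast hC.card_pos.ne'
    simp only [hammingDist_eq_zero, Finset.sum_ite_eq]
    rw [Finset.sum_congr rfl fun x hx => if_pos hx]
    simp [this]
  nonneg a b c _ := by rw [tripleDistribution_eq]; positivity
  symm p τ _ := tripleDistribution_perm C p τ
  le_c a b c h := tripleDistribution_le C h
  le_a a b c h := by
    rw [tripleDistribution_swap_left, tripleDistribution_swap_right]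
    exact tripleDistribution_le C (mem_Omega_rotate h)
  le_b a b c h := by
    rw [tripleDistribution_swap_right, tripleDistribution_swap_left]
    exact tripleDistribution_le C (mem_Omega_rotate (mem_Omega_rotate h))
  psd k _ := by
    simp only [tripleDistribution_eq, mul_smul, ← Finset.smul_sum]
    exact (posSemidef_sum_tripleCount k C C).smul (by positivity)
  psd_compl k _ := by
    have : ∀ p ∈ Omega n, ((tCount n p.1 p.2.1 p.2.2 : ℝ) * _root_.tripleDistribution C 0 p.2.2 p.2.2
        - _root_.tripleDistribution C p.1 p.2.1 p.2.2) • schrijverT n k p.1 p.2.1 p.2.2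
        = (1 / (C.card : ℝ)) • (tripleCount C Cᶜ p.1 p.2.1 p.2.2 : ℝ) •
          schrijverT n k p.1 p.2.1 p.2.2 := by
      intro p hp
      rw [tCount_mul_tripleDistribution C hp, add_sub_cancel_left, mul_smul]
    rw [Finset.sum_congr rfl this, ← Finset.smul_sum]
    exact (posSemidef_sum_tripleCount k C Cᶜ).smul (by positivity)
  vanish a b c _ h := tripleDistribution_eq_zero C fun x hx y hy z hz ⟨ha, hb, hc⟩ =>
    hI x hx y hy z hz (by rw [ha, hb, hc]; exact h)

theorem sdpObjective_tripleDistribution {C : Finset (BinHamming n)} (hC : C.Nonempty) :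
    sdpObjective n (tripleDistribution C) = C.card := by
  have h0 : (C.card : ℝ) ≠ 0 := by exact_mod_cast hC.card_pos.ne'
  have h : ∑ c ∈ Finset.range (n + 1), tripleCount C C 0 c c = C.card * C.card := by
    simp only [tripleCount_pair]
    rw [Finset.sum_comm, Finset.sum_congr rfl fun x _ => Finset.sum_comm]
    have : ∀ x y : BinHamming n,
        ∑ c ∈ Finset.range (n + 1), (if hammingDist x y = c then 1 else 0) = 1 := by
      intro x y
      rw [Finset.sum_ite_eq, if_pos]
      have := hammingDist_le_card_fintype (x := x) (y := y)
      rw [Fintype.card_fin] at this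
      exact Finset.mem_range.mpr (by omega)
    simp [this]
  unfold sdpObjective
  simp only [tripleDistribution_eq]
  rw [← Finset.mul_sum, ← Nat.cast_sum, h]
  push_cast
  field_simp

end TripleCount

/-! ### Radius, average radius and generalized distance of three words -/

section Radius

variable {n : ℕ}

/-- The coordinates where the first word differs from both others. -/
def aloneSet (x y z : BinHamming n) : Finset (Fin n) :=
  Finset.univ.filter fun j => x j ≠ y j ∧ x j ≠ z j

theorem aloneSet_swap (x y z : BinHamming n) : aloneSet x y z = aloneSet x z y := by
  unfold aloneSet; simp only [and_comm]

/-- With two letters, wherever `x` and `y` differ, `z` agrees with exactly one of them. -/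
theorem hammingDist_eq_card_aloneSet (x y z : BinHamming n) :
    hammingDist x y = (aloneSet x y z).card + (aloneSet y x z).card := by
  rw [← Finset.card_union_of_disjoint]
  · unfold hammingDist
    congr 1
    ext j
    simp only [aloneSet, Finset.mem_union, Finset.mem_filter, Finset.mem_univ, true_and]
    generalize x j = u; generalize y j = v; generalize z j = w
    revert u v w; decide
  · rw [Finset.disjoint_left]
    intro j
    simp only [aloneSet, Finset.mem_filter, Finset.mem_univ, true_and]
    generalize x j = u; generalize y j = v; generalize z j = w
    revert u v w; decide

/-- The coordinatewise majority can be moved towards `x` along any part of `aloneSet x y z`. -/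
theorem exists_center (x y z : BinHamming n) {W : Finset (Fin n)} (hW : W ⊆ aloneSet x y z) :
    ∃ u : BinHamming n, hammingDist u x ≤ (aloneSet x y z).card - W.card ∧
      hammingDist u y ≤ (aloneSet y x z).card + W.card ∧
      hammingDist u z ≤ (aloneSet z x y).card + W.card := by
  -- Off `W` this is the majority letter: if `x j ≠ y j`, then `z j` equals one of them.
  refine ⟨fun j => if j ∈ W then x j else if x j = y j then x j else z j, ?_, ?_, ?_⟩
  · rw [← Finset.card_sdiff_of_subset hW]
    refine Finset.card_le_card ?_
    intro j
    simp only [aloneSet, Finset.mem_sdiff, Finset.mem_filter, Finset.mem_univ, true_and]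
    by_cases hp : j ∈ W <;> simp only [hp, if_true, if_false]
    · simp
    · generalize x j = u; generalize y j = v; generalize z j = w
      revert u v w; decide
  · refine (Finset.card_le_card ?_).trans (Finset.card_union_le _ _)
    intro j
    simp only [aloneSet, Finset.mem_union, Finset.mem_filter, Finset.mem_univ, true_and]
    by_cases hp : j ∈ W <;> simp only [hp, if_true, if_false]
    · simp
    · generalize x j = u; generalize y j = v; generalize z j = w
      revert u v w; decide
  · refine (Finset.card_le_card ?_).trans (Finset.card_union_le _ _)
    intro j
    simp only [aloneSet, Finset.mem_union, Finset.mem_filter, Finset.mem_univ, true_and]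
    by_cases hp : j ∈ W <;> simp only [hp, if_true, if_false]
    · simp
    · generalize x j = u; generalize y j = v; generalize z j = w
      revert u v w; decide

theorem exists_ball_of_aloneSet_le {x y z : BinHamming n} {ρ : ℕ}
    (hxy : hammingDist x y ≤ 2 * ρ) (hxz : hammingDist x z ≤ 2 * ρ)
    (hy : (aloneSet y x z).card ≤ ρ) (hz : (aloneSet z x y).card ≤ ρ) :
    ∃ u : BinHamming n, hammingDist u x ≤ ρ ∧ hammingDist u y ≤ ρ ∧ hammingDist u z ≤ ρ := by
  -- Move just far enough to reach distance `ρ` from `x`; truncated subtraction gives `W = ∅` if no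
  -- move is needed. Otherwise the distance to `y` is at most `d(x,y) - ρ ≤ ρ`, and likewise for
  -- `z`.
  obtain ⟨W, hW, hWc⟩ := Finset.exists_subset_card_eq
    (Nat.sub_le (aloneSet x y z).card ρ)
  obtain ⟨u, h1, h2, h3⟩ := exists_center x y z hW
  have e1 := hammingDist_eq_card_aloneSet x y z
  have e2 := hammingDist_eq_card_aloneSet x z y
  rw [aloneSet_swap x z y] at e2
  exact ⟨u, by omega, by omega, by omega⟩

/-- Three binary words with pairwise distances at most `2ρ` lie in a ball of radius `ρ`. -/
theorem exists_ball_of_hammingDist_le {x y z : BinHamming n} {ρ : ℕ}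
    (hxy : hammingDist x y ≤ 2 * ρ) (hxz : hammingDist x z ≤ 2 * ρ)
    (hyz : hammingDist y z ≤ 2 * ρ) :
    ∃ u : BinHamming n, hammingDist u x ≤ ρ ∧ hammingDist u y ≤ ρ ∧ hammingDist u z ≤ ρ := by
  have e1 := hammingDist_eq_card_aloneSet x y z
  have e2 := hammingDist_eq_card_aloneSet x z y
  have e3 := hammingDist_eq_card_aloneSet y z x
  rw [aloneSet_swap x z y] at e2
  rw [aloneSet_swap y z x, aloneSet_swap z y x] at e3
  -- Two of these sets have sizes adding up to a distance `≤ 2ρ`, so at most one exceeds `ρ`; its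
  -- word is the one to move towards.
  by_cases hx : ρ < (aloneSet x y z).card
  · exact exists_ball_of_aloneSet_le hxy hxz (by omega) (by omega)
  by_cases hy : ρ < (aloneSet y x z).card
  · obtain ⟨u, h1, h2, h3⟩ := exists_ball_of_aloneSet_le (x := y) (y := x) (z := z) (ρ := ρ)
      (by rwa [hammingDist_comm]) hyz (by omega) (by rw [aloneSet_swap]; omega)
    exact ⟨u, h2, h1, h3⟩
  · obtain ⟨u, h1, h2, h3⟩ := exists_ball_of_aloneSet_le (x := z) (y := x) (z := y) (ρ := ρ)
      (by rwa [hammingDist_comm]) (by rwa [hammingDist_comm]) (by rw [aloneSet_swap]; omega)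
      (by rw [aloneSet_swap]; omega)
    exact ⟨u, h2, h3, h1⟩

theorem radius_le {x y z : BinHamming n} {ρ : ℕ}
    (hxy : hammingDist x y ≤ 2 * ρ) (hxz : hammingDist x z ≤ 2 * ρ)
    (hyz : hammingDist y z ≤ 2 * ρ) : radius ![x, y, z] ≤ ρ := by
  obtain ⟨u, h1, h2, h3⟩ := exists_ball_of_hammingDist_le hxy hxz hyz
  refine Nat.sInf_le ⟨u, fun i => ?_⟩
  fin_cases i
  exacts [h1, h2, h3]

/-- The majority word as centre gives a distance sum of at most the total size of the three
alone-sets, which is half of `a + b + c`. -/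
theorem six_mul_avgRadius_le (x y z : BinHamming n) :
    6 * avgRadius ![x, y, z] ≤ (hammingDist y z : ℝ) + hammingDist x z + hammingDist x y := by
  obtain ⟨u, h1, h2, h3⟩ := exists_center x y z (Finset.empty_subset _)
  rw [Finset.card_empty] at h1 h2 h3
  have e1 := hammingDist_eq_card_aloneSet x y z
  have e2 := hammingDist_eq_card_aloneSet x z y
  have e3 := hammingDist_eq_card_aloneSet y z x
  rw [aloneSet_swap x z y] at e2
  rw [aloneSet_swap y z x, aloneSet_swap z y x] at e3
  have h : 2 * ((hammingDist u x : ℝ) + hammingDist u y + hammingDist u z)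
      ≤ hammingDist y z + hammingDist x z + hammingDist x y := by
    exact_mod_cast (by omega : 2 * (hammingDist u x + hammingDist u y + hammingDist u z)
      ≤ hammingDist y z + hammingDist x z + hammingDist x y)
  have hle : avgRadius ![x, y, z]
      ≤ (1 / ((3 : ℕ) : ℝ)) * ∑ i, (hammingDist u (![x, y, z] i) : ℝ) :=
    ciInf_le (Set.finite_range _).bddBelow u
  simp only [Fin.sum_univ_three, Matrix.cons_val_zero, Matrix.cons_val_one, Matrix.cons_val] at hle
  push_cast at hle
  linarith

theorem two_mul_genDist_le (x y z : BinHamming n) :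
    2 * genDist ![x, y, z] ≤ hammingDist y z + hammingDist x z + hammingDist x y := by
  have h1 := hammingDist_add_two_mul_inter x y z
  have h2 := Finset.card_union_add_card_inter (diffSet x z) (diffSet y z)
  have h3 : genDist ![x, y, z] ≤ (diffSet x z ∪ diffSet y z).card := by
    refine Finset.card_le_card fun j => ?_
    simp only [diffSet, Finset.mem_union, Finset.mem_filter, Finset.mem_univ, true_and]
    rintro ⟨i, i', h⟩
    by_contra! hc
    apply h
    have : ∀ i : Fin 3, (![x, y, z] i) j = z j := by
      intro i
      fin_cases i
      exacts [hc.1, hc.2, rfl]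
    rw [this i, this i']
  rw [card_diffSet, card_diffSet] at h2
  omega

theorem codeMin_le {f : (Fin 3 → BinHamming n) → ℝ} {C : Finset (BinHamming n)} {r : ℝ}
    (h : (r : EReal) ≤ codeMin f C) {x y z : BinHamming n} (hx : x ∈ C) (hy : y ∈ C) (hz : z ∈ C)
    (hne : hammingDist y z * hammingDist x z * hammingDist x y ≠ 0) : r ≤ f ![x, y, z] := by
  have hyz : y ≠ z := fun e => hne (by simp [e])
  have hxz : x ≠ z := fun e => hne (by simp [e])
  have hxy : x ≠ y := fun e => hne (by simp [e])
  have hinj : Function.Injective ![x, y, z] := by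
    intro i j hij
    fin_cases i <;> fin_cases j <;> simp_all [eq_comm]
  have hmem : ∀ i, ![x, y, z] i ∈ C := by
    intro i
    fin_cases i
    exacts [hx, hy, hz]
  unfold codeMin at h
  rw [le_iInf_iff] at h
  exact EReal.coe_le_coe_iff.mp (h ⟨![x, y, z], hinj, hmem⟩)

end Radius

/-! ### Compactness and attainment of the maximum -/

section Optimum

theorem Matrix.isClosed_setOf_posSemidef {ι : Type*} [Fintype ι] :
    IsClosed {M : Matrix ι ι ℝ | M.PosSemidef} := by
  simp only [Matrix.posSemidef_iff_dotProduct_mulVec, Matrix.IsHermitian, Set.ofPred_and,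
    Set.ofPred_forall]
  refine IsClosed.inter (isClosed_eq (by fun_prop) continuous_id) (isClosed_iInter fun v => ?_)
  exact isClosed_le continuous_const (by fun_prop)

theorem isClosed_setOf_SDPFeasible (n : ℕ) (I : Set (ℕ × ℕ × ℕ)) :
    IsClosed {x | SDPFeasible n I x} := by
  have h : {x | SDPFeasible n I x} =
      {x : ℕ → ℕ → ℕ → ℝ | ∀ a b c, (a, b, c) ∉ Omega n → x a b c = 0} ∩ {x | x 0 0 0 = 1} ∩
      {x | ∀ a b c, (a, b, c) ∈ Omega n → 0 ≤ x a b c} ∩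
      {x | ∀ (p : Fin 3 → ℕ) (τ : Equiv.Perm (Fin 3)), (p 0, p 1, p 2) ∈ Omega n →
        x (p 0) (p 1) (p 2) = x (p (τ 0)) (p (τ 1)) (p (τ 2))} ∩
      {x | ∀ a b c, (a, b, c) ∈ Omega n → x a b c ≤ (tCount n a b c : ℝ) * x 0 c c} ∩
      {x | ∀ a b c, (a, b, c) ∈ Omega n → x a b c ≤ (tCount n b c a : ℝ) * x 0 a a} ∩
      {x | ∀ a b c, (a, b, c) ∈ Omega n → x a b c ≤ (tCount n c a b : ℝ) * x 0 b b} ∩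
      {x | ∀ k ≤ n / 2,
        (∑ p ∈ Omega n, x p.1 p.2.1 p.2.2 • schrijverT n k p.1 p.2.1 p.2.2).PosSemidef} ∩
      {x | ∀ k ≤ n / 2, (∑ p ∈ Omega n,
        ((tCount n p.1 p.2.1 p.2.2 : ℝ) * x 0 p.2.2 p.2.2 - x p.1 p.2.1 p.2.2) •
          schrijverT n k p.1 p.2.1 p.2.2).PosSemidef} ∩
      {x | ∀ a b c, (a, b, c) ∈ Omega n → (a, b, c) ∈ I → x a b c = 0} := by
    ext x
    constructor
    · intro h
      exact ⟨⟨⟨⟨⟨⟨⟨⟨⟨h.support, h.normalized⟩, h.nonneg⟩, h.symm⟩, h.le_c⟩, h.le_a⟩, h.le_b⟩,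
        h.psd⟩, h.psd_compl⟩, h.vanish⟩
    · rintro ⟨⟨⟨⟨⟨⟨⟨⟨⟨h0, h1⟩, h2⟩, h3⟩, h4⟩, h5⟩, h6⟩, h7⟩, h8⟩, h9⟩
      exact ⟨h0, h1, h2, h3, h4, h5, h6, h7, h8, h9⟩
  rw [h]
  simp only [Set.ofPred_forall]
  have hx : ∀ a b c : ℕ, Continuous fun x : ℕ → ℕ → ℕ → ℝ => x a b c := fun a b c => by fun_prop
  refine ((((((((IsClosed.inter ?_ ?_).inter ?_).inter ?_).inter ?_).inter ?_).inter ?_).inter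
    ?_).inter ?_).inter ?_
  · exact isClosed_iInter fun a => isClosed_iInter fun b => isClosed_iInter fun c =>
      isClosed_iInter fun _ => isClosed_eq (hx _ _ _) continuous_const
  · exact isClosed_eq (hx _ _ _) continuous_const
  · exact isClosed_iInter fun a => isClosed_iInter fun b => isClosed_iInter fun c =>
      isClosed_iInter fun _ => isClosed_le continuous_const (hx _ _ _)
  · exact isClosed_iInter fun p => isClosed_iInter fun τ => isClosed_iInter fun _ =>
      isClosed_eq (hx _ _ _) (hx _ _ _)
  · exact isClosed_iInter fun a => isClosed_iInter fun b => isClosed_iInter fun c =>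
      isClosed_iInter fun _ => isClosed_le (hx _ _ _) (continuous_const.mul (hx _ _ _))
  · exact isClosed_iInter fun a => isClosed_iInter fun b => isClosed_iInter fun c =>
      isClosed_iInter fun _ => isClosed_le (hx _ _ _) (continuous_const.mul (hx _ _ _))
  · exact isClosed_iInter fun a => isClosed_iInter fun b => isClosed_iInter fun c =>
      isClosed_iInter fun _ => isClosed_le (hx _ _ _) (continuous_const.mul (hx _ _ _))
  · exact isClosed_iInter fun k => isClosed_iInter fun _ =>
      Matrix.isClosed_setOf_posSemidef.preimage
        (continuous_finsetSum _ fun p _ => (hx _ _ _).smul continuous_const)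
  · exact isClosed_iInter fun k => isClosed_iInter fun _ =>
      Matrix.isClosed_setOf_posSemidef.preimage
        (continuous_finsetSum _ fun p _ =>
          ((continuous_const.mul (hx _ _ _)).sub (hx _ _ _)).smul continuous_const)
  · exact isClosed_iInter fun a => isClosed_iInter fun b => isClosed_iInter fun c =>
      isClosed_iInter fun _ => isClosed_iInter fun _ => isClosed_eq (hx _ _ _) continuous_const

theorem SDPFeasible.mem_Icc {n : ℕ} {I : Set (ℕ × ℕ × ℕ)} {x : ℕ → ℕ → ℕ → ℝ}
    (h : SDPFeasible n I x) (a b c : ℕ) :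
    x a b c ∈ Set.Icc (0 : ℝ) (tCount n a b c * tCount n c c 0) := by
  by_cases hO : (a, b, c) ∈ Omega n
  · refine ⟨h.nonneg a b c hO, (h.le_c a b c hO).trans ?_⟩
    have h0 : (0, c, c) ∈ Omega n := by
      simp only [Omega, Finset.mem_filter, Finset.mem_product, Finset.mem_range] at hO ⊢
      omega
    -- Constraint (v) at `(0, c, c)` bounds `x 0 c c` by a multiple of `x 0 0 0 = 1`; with (iv) this
    -- bounds every unknown.
    have h1 := h.le_a 0 c c h0
    rw [h.normalized, mul_one] at h1
    exact mul_le_mul_of_nonneg_left h1 (Nat.cast_nonneg _)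
  · rw [h.support a b c hO]
    exact ⟨le_rfl, by positivity⟩

/-- A closed subset of a product of intervals is compact by Tychonoff, so the infinite index set is
harmless. -/
theorem isCompact_setOf_SDPFeasible (n : ℕ) (I : Set (ℕ × ℕ × ℕ)) :
    IsCompact {x | SDPFeasible n I x} := by
  have hK : IsCompact (Set.pi Set.univ fun a : ℕ => Set.pi Set.univ fun b : ℕ =>
      Set.pi Set.univ fun c : ℕ => Set.Icc (0 : ℝ) (tCount n a b c * tCount n c c 0)) :=
    isCompact_univ_pi fun a => isCompact_univ_pi fun b => isCompact_univ_pi fun c => isCompact_Icc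
  exact hK.of_isClosed_subset (isClosed_setOf_SDPFeasible n I)
    fun x hx a _ b _ c _ => hx.mem_Icc a b c

theorem isCompact_sdpValues (n : ℕ) (I : Set (ℕ × ℕ × ℕ)) : IsCompact (sdpValues n I) := by
  refine (isCompact_setOf_SDPFeasible n I).image ?_
  unfold sdpObjective
  fun_prop

/-- The program is feasible because the code `{0}` has only the triple `(0,0,0)`, which is never
forbidden. -/
theorem isGreatest_sdpOptimum {n : ℕ} {I : Set (ℕ × ℕ × ℕ)} (hI : ∀ p ∈ I, p.1 * p.2.1 * p.2.2 ≠ 0) :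
    IsGreatest (sdpValues n I) (sdpOptimum n I) := by
  refine (isCompact_sdpValues n I).isGreatest_sSup ⟨_, Set.mem_image_of_mem _
    (SDPFeasible.tripleDistribution (Finset.singleton_nonempty 0) fun x hx y hy z hz hmem =>
      hI _ hmem ?_)⟩
  rw [Finset.mem_singleton.mp hx, Finset.mem_singleton.mp hy]
  simp

theorem sdp_bound {n : ℕ} {C : Finset (BinHamming n)} {I : Set (ℕ × ℕ × ℕ)}
    (hI : ∀ p ∈ I, p.1 * p.2.1 * p.2.2 ≠ 0)
    (hC : ∀ x ∈ C, ∀ y ∈ C, ∀ z ∈ C,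
      (hammingDist y z, hammingDist x z, hammingDist x y) ∉ I) :
    (C.Nonempty → SDPFeasible n I (tripleDistribution C) ∧
        sdpObjective n (tripleDistribution C) = (C.card : ℝ)) ∧
      IsGreatest (sdpValues n I) (sdpOptimum n I) ∧ (C.card : ℝ) ≤ sdpOptimum n I := by
  refine ⟨fun hne => ⟨.tripleDistribution hne hC, sdpObjective_tripleDistribution hne⟩,
    isGreatest_sdpOptimum hI, ?_⟩
  -- The distribution of the empty code is identically `0` and violates `x 0 0 0 = 1`; there it
  -- suffices that objective values are nonnegative.
  rcases C.eq_empty_or_nonempty with rfl | hne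
  · obtain ⟨x, hx, hxe⟩ := (isGreatest_sdpOptimum (n := n) hI).1
    rw [← hxe, Finset.card_empty, Nat.cast_zero]
    exact Finset.sum_nonneg fun c _ => (hx.mem_Icc 0 c c).1
  · exact (isGreatest_sdpOptimum hI).2 ⟨_, .tripleDistribution hne hC,
      sdpObjective_tripleDistribution hne⟩

end Optimum

/-! ### The three bounds -/

theorem mainTheorem1 (n : ℕ) (C : Finset (BinHamming n)) :
    (∀ d : ℕ, ((d : ℝ) : EReal) ≤ d₂ C →
      (C.Nonempty → SDPFeasible n (forbidD d) (tripleDistribution C) ∧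
        sdpObjective n (tripleDistribution C) = (C.card : ℝ)) ∧
      IsGreatest (sdpValues n (forbidD d)) (sdpOptimum n (forbidD d)) ∧
      (C.card : ℝ) ≤ sdpOptimum n (forbidD d)) ∧
    (∀ r : ℕ, ((r : ℝ) : EReal) ≤ r₂ C →
      (C.Nonempty → SDPFeasible n (forbidR r) (tripleDistribution C) ∧
        sdpObjective n (tripleDistribution C) = (C.card : ℝ)) ∧
      IsGreatest (sdpValues n (forbidR r)) (sdpOptimum n (forbidR r)) ∧
      (C.card : ℝ) ≤ sdpOptimum n (forbidR r)) ∧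
    (∀ ρ : ℝ, (ρ : EReal) ≤ rbar₂ C →
      (C.Nonempty → SDPFeasible n (forbidRbar ρ) (tripleDistribution C) ∧
        sdpObjective n (tripleDistribution C) = (C.card : ℝ)) ∧
      IsGreatest (sdpValues n (forbidRbar ρ)) (sdpOptimum n (forbidRbar ρ)) ∧
      (C.card : ℝ) ≤ sdpOptimum n (forbidRbar ρ)) := by
  refine ⟨fun d hd => sdp_bound (fun p hp => hp.1) ?_, fun r hr => sdp_bound (fun p hp => hp.1) ?_,
    fun ρ hρ => sdp_bound (fun p hp => hp.1) ?_⟩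
  · rintro x hx y hy z hz ⟨hne, hle⟩
    have h1 : d ≤ genDist ![x, y, z] := by exact_mod_cast codeMin_le hd hx hy hz hne
    have h2 := two_mul_genDist_le x y z
    simp only at hle
    omega
  · rintro x hx y hy z hz ⟨hne, hle⟩
    have h1 : r ≤ radius ![x, y, z] := by exact_mod_cast codeMin_le hr hx hy hz hne
    simp only [max_le_iff, Int.ceil_le] at hle
    -- For `r = 0` no triple is forbidden, as a halved distance is never `≤ -1`. Hence `ρ = r - 1`
    -- is a natural number, and a forbidden triple would have radius at most `ρ < r`.
    have h0 : 1 ≤ r := by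
      by_contra h
      have hr0 : r = 0 := by omega
      have h2 := hle.2
      rw [hr0] at h2
      push_cast at h2
      have : (0 : ℝ) ≤ (hammingDist x y : ℝ) / 2 := by positivity
      linarith
    obtain ⟨ρ, rfl⟩ := Nat.exists_eq_add_of_le' h0
    have hd : ∀ a : ℕ, (a : ℝ) / 2 ≤ (((ρ + 1 : ℕ) : ℤ) - 1 : ℤ) → a ≤ 2 * ρ := by
      intro a ha
      push_cast at ha
      have : (a : ℝ) ≤ 2 * ρ := by linarith
      exact_mod_cast this
    have h2 := radius_le (hd _ hle.2) (hd _ hle.1.2) (hd _ hle.1.1)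
    omega
  · rintro x hx y hy z hz ⟨hne, hlt⟩
    have h1 : ρ ≤ avgRadius ![x, y, z] := codeMin_le hρ hx hy hz hne
    have h2 := six_mul_avgRadius_le x y z
    simp only at hlt
    linarith
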